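/- **Setting.** Fix a signature $\mathcal F$ and an infinite set of variables $\mathcal V$; terms are over $\mathcal F$ and $\mathcal V$. An *equational system* (ES) is a set of pairs of terms $s\approx t$; a *term rewrite system* (TRS) is a set of pairs $\ell\to r$ such that $\ell$ is not a variable and $\mathrm{Var}(r)\subseteq\mathrm{Var}(\ell)$. For a set of pairs $\mathcal E$, $\to_{\mathcal E}$ is its closure under substitutions and contexts, $\leftrightarrow_{\mathcal E}$ is the symmetric closure of $\to_{\mathcal E}$, $\leftrightarrow^*_{\mathcal E}$ is the reflexive and transitive closure of $\leftrightarrow_{\mathcal E}$, and $\mathcal E^\pm=\mathcal E\cup\{t\approx s\mid s\approx t\in\mathcal E\}$. Fix an ES $\mathcal B$ with $\mathrm{Var}(\ell)=\mathrm{Var}(r)$ for all $\ell\approx r\in\mathcal B$. Write $\sim$ for $\leftrightarrow^*_{\mathcal B}$, $\to_{\mathcal R/\mathcal B}$ for $\sim\cdot\to_{\mathcal R}\cdot\sim$, and $\downarrow^\sim_{\mathcal R}$ for $\to^*_{\mathcal R}\cdot\sim\cdot{}^*_{\mathcal R}{\leftarrow}$. A *$\mathcal B$-compatible reduction order* is a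 well-founded strict order $>$ on terms that is closed under contexts and substitutions and satisfies ${\sim\cdot>\cdot\sim}\subseteq{>}$. **Inference system $\mathcal I_A$.** For a fixed $\mathcal B$-compatible reduction order $>$, the steps $(\mathcal E,\mathcal R)\vdash(\mathcal E',\mathcal R')$ are the following, where $\uplus$ is disjoint union and $s\mathrel{\dot\approx}t$ denotes either $s\approx t$ or $t\approx s$: - deduce: $(\mathcal E,\mathcal R)\vdash(\mathcal E\cup\{s\approx t\},\mathcal R)$ if $s\mathrel{{}_{\mathcal R}{\leftarrow}}\cdot\to_{\mathcal R}t$; - deduce: $(\mathcal E,\mathcal R)\vdash(\mathcal E,\mathcal R\cup\{t\to s\})$ if $s\mathrel{{}_{\mathcal R}{\leftarrow}}\cdot\leftrightarrow_{\mathcal B}t$; - orient: $(\mathcal E\uplus\{s\mathrel{\dot\approx}t\},\mathcal R)\vdash(\mathcal E,\mathcal R\cup\{s\to t\})$ if $s>t$; - delete: $(\mathcal E\uplus\{s\approx t\},\mathcal R)\vdash(\mathcal E,\mathcal R)$ if $s\sim t$; - simplify: $(\mathcal E\uplus\{s\mathrel{\dot\approx}t\},\mathcal R)\vdash(\mathcal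 E\cup\{u\approx t\},\mathcal R)$ if $s\to_{\mathcal R/\mathcal B}u$; - collapse: $(\mathcal E,\mathcal R\uplus\{s\to t\})\vdash(\mathcal E\cup\{u\approx t\},\mathcal R)$ if $s\to_{\mathcal R}u$; - compose: $(\mathcal E,\mathcal R\uplus\{s\to t\})\vdash(\mathcal E,\mathcal R\cup\{s\to u\})$ if $t\to_{\mathcal R/\mathcal B}u$. **Prime critical pairs.** For sets of pairs $\mathcal S_1,\mathcal S_2$, let $\ell_1\to r_1$ and $\ell_2\to r_2$ be variants, without common variables, of members of $\mathcal S_1$ and $\mathcal S_2$ respectively, let $p$ be a function symbol position of $\ell_2$ such that $\ell_1$ and $\ell_2|_p$ are unifiable with most general unifier $\sigma$, and, if $p$ is the root position, suppose that the two pairs are not variants of each other. This gives the critical peak with source $s=\ell_2\sigma$, position $p$ and critical pair $\ell_2\sigma[r_1\sigma]_p\approx r_2\sigma$. It is *prime* with respect to $\mathcal R$ if all proper subterms of $s|_p$ are $\to_{\mathcal R}$-normal forms. $\mathrm{PCP}(\mathcal R)$ is the set of critical pairs of prime critical peaks with $\mathcal S_1=\mathcal S_2=\mathcal R$; $\mathrm{PCP}^\pm(\mathcal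 R,\mathcal B^\pm)$ is the set of critical pairs of critical peaks with $(\mathcal S_1,\mathcal S_2)=(\mathcal R,\mathcal B^\pm)$ or $(\mathcal B^\pm,\mathcal R)$ that are prime with respect to $\mathcal R$. **Runs.** A *run* for an ES $\mathcal E$ is a finite sequence $(\mathcal E_0,\mathcal R_0)\vdash(\mathcal E_1,\mathcal R_1)\vdash\cdots\vdash(\mathcal E_n,\mathcal R_n)$ of $\mathcal I_A$-steps with $\mathcal E_0=\mathcal E$ and $\mathcal R_0=\varnothing$. It is *non-failing* if $\mathcal E_n=\varnothing$. It is *fair* if $\mathcal R_n$ is left-linear and $$\mathrm{PCP}(\mathcal R_n)\subseteq{\downarrow^\sim_{\mathcal R_n}}\cup\bigcup_{i=0}^n{\leftrightarrow_{\mathcal E_i\cup\mathcal R_i}},\qquad \mathrm{PCP}^\pm(\mathcal R_n,\mathcal B^\pm)\subseteq{\downarrow^\sim_{\mathcal R_n}}\cup\bigcup_{i=0}^n{\leftrightarrow_{\mathcal R_i}}.$$ **Theorem.** Let $\mathcal E$ be an ES. For every fair and non-failing run $(\mathcal E_0,\mathcal R_0)\vdash\cdots\vdash(\mathcal E_n,\mathcal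 R_n)$ for $\mathcal E$, the set $\mathcal R_n$ is a TRS that is a $\mathcal B$-complete representation of $\mathcal E$, that is: 1. ${\leftrightarrow^*_{\mathcal E\cup\mathcal B}}={\leftrightarrow^*_{\mathcal R_n\cup\mathcal B}}$; 2. $\mathcal R_n$ is terminating modulo $\mathcal B$: there is no infinite sequence $t_0\to_{\mathcal R_n/\mathcal B}t_1\to_{\mathcal R_n/\mathcal B}\cdots$; 3. $\mathcal R_n$ is Church–Rosser modulo $\mathcal B$: $({{}_{\mathcal R_n}{\leftarrow}}\cup{\to_{\mathcal R_n}}\cup{\sim})^*\subseteq{\downarrow^\sim_{\mathcal R_n}}$. -/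

import Mathlib

universe u v w

namespace TRS

open FirstOrder FirstOrder.Language

variable {L : FirstOrder.Language.{u, v}} {V : Type w}

/-- A set of ordered pairs of terms over the function symbols of `L` and the variables `V`.
It is read as a set of equations (an ES) or as a set of rules (a TRS, see `IsTRS`). -/
abbrev PairSet (L : FirstOrder.Language.{u, v}) (V : Type w) : Type (max u w) :=
  Set (L.Term V × L.Term V)

/-! ### Terms, positions, substitutions

Substitutions are mappings `V → L.Term V`, applied with `Term.subst`; as a term has only finitely
many variables, requiring finite domains would change none of the notions below. -/

/-- The variables that occur in a term. -/
noncomputable def vars (t : L.Term V) : Finset V :=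
  @Term.varFinset L V (Classical.decEq V) t

/-- The subterm `t|_p`; it is `none` if `p` is not a position of `t`. Positions are lists of
argument indices, counted from `0`. -/
def subtermAt : L.Term V → List ℕ → Option (L.Term V)
  | t, [] => some t
  | .var _, _ :: _ => none
  | @Term.func _ _ k _ ts, i :: p => if h : i < k then subtermAt (ts ⟨i, h⟩) p else none

/-- The term `s[t]_p`; it is only used at positions `p` of `s`. -/
def replaceAt : L.Term V → List ℕ → L.Term V → L.Term V
  | _, [], t => t
  | .var x, _ :: _, _ => .var x
  | .func f ts, i :: p, t =>
      .func f fun j => if (j : ℕ) = i then replaceAt (ts j) p t else ts j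

/-- `p` is a position of `t`. -/
def IsPos (t : L.Term V) (p : List ℕ) : Prop := ∃ u, subtermAt t p = some u

/-- `p` is a position of `t` that addresses a function symbol. -/
def IsFunPos (t : L.Term V) (p : List ℕ) : Prop :=
  ∃ (k : ℕ) (f : L.Functions k) (ts : Fin k → L.Term V), subtermAt t p = some (.func f ts)

/-- No variable occurs more than once in `t`. -/
def IsLinear (t : L.Term V) : Prop :=
  ∀ (x : V) (p q : List ℕ),
    subtermAt t p = some (.var x) → subtermAt t q = some (.var x) → p = q

/-- The rules `l₁ → r₁` and `l₂ → r₂` are variants: a renaming (a bijection of the variables)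
maps the first to the second. -/
def IsVariant (l₁ r₁ l₂ r₂ : L.Term V) : Prop :=
  ∃ π : Equiv.Perm V, l₁.relabel π = l₂ ∧ r₁.relabel π = r₂

/-- `σ` is a unifier of `s` and `t`. -/
def IsUnifier (σ : V → L.Term V) (s t : L.Term V) : Prop := s.subst σ = t.subst σ

/-- `σ` is a most general unifier of `s` and `t`. -/
def IsMGU (σ : V → L.Term V) (s t : L.Term V) : Prop :=
  IsUnifier σ s t ∧
    ∀ τ : V → L.Term V, IsUnifier τ s t → ∃ δ : V → L.Term V, ∀ x, τ x = (σ x).subst δ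

/-! ### Rewriting -/

/-- Every left-hand side is not a variable and contains all variables of its right-hand side. -/
def IsTRS (R : PairSet L V) : Prop :=
  ∀ l r, (l, r) ∈ R → (∀ x, l ≠ .var x) ∧ vars r ⊆ vars l

/-- All left-hand sides are linear. -/
def IsLeftLinear (R : PairSet L V) : Prop := ∀ l r, (l, r) ∈ R → IsLinear l

/-- `s →_E t`. -/
def Rew (E : PairSet L V) (s t : L.Term V) : Prop :=
  ∃ (l r : L.Term V) (p : List ℕ) (σ : V → L.Term V), (l, r) ∈ E ∧
    subtermAt s p = some (l.subst σ) ∧ t = replaceAt s p (r.subst σ)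

/-- `s ↔_E t`. -/
def SymRew (E : PairSet L V) (s t : L.Term V) : Prop := Rew E s t ∨ Rew E t s

/-- `s ↔*_E t`, the equational theory of `E`. For a base theory `B` this is `s ∼_B t`. -/
def Conv (E : PairSet L V) : L.Term V → L.Term V → Prop :=
  Relation.ReflTransGen (SymRew E)

/-- `t` is a normal form with respect to `→_R`. -/
def IsNF (R : PairSet L V) (t : L.Term V) : Prop := ¬ ∃ u, Rew R t u

/-- `E^±`, the set of all pairs of `E` and their reversals. -/
def symmPairs (E : PairSet L V) : PairSet L V := {e | e ∈ E ∨ e.swap ∈ E}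

/-! ### Rewriting modulo `B` -/

/-- `s →_{R/B} t`, i.e. `s ∼_B · →_R · ∼_B t`. -/
def RewMod (R B : PairSet L V) (s t : L.Term V) : Prop :=
  ∃ s' t', Conv B s s' ∧ Rew R s' t' ∧ Conv B t' t

/-- `s →*_R · ∼_B · *←_R t`, a valley modulo `B`. -/
def Valley (R B : PairSet L V) (s t : L.Term V) : Prop :=
  ∃ s' t', Relation.ReflTransGen (Rew R) s s' ∧ Conv B s' t' ∧ Relation.ReflTransGen (Rew R) t t'

/-- There is no infinite rewrite sequence with `→_{R/B}`. -/
def TerminatingMod (R B : PairSet L V) : Prop :=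
  ¬ ∃ f : ℕ → L.Term V, ∀ i, RewMod R B (f i) (f (i + 1))

/-- Any two terms connected by steps `←_R`, `→_R` and `∼_B` have a valley modulo `B`. -/
def ChurchRosserMod (R B : PairSet L V) : Prop :=
  ∀ s t, Relation.ReflTransGen (fun a b => Rew R b a ∨ Rew R a b ∨ Conv B a b) s t →
    Valley R B s t

/-- `R` is complete modulo `B`. -/
def CompleteMod (R B : PairSet L V) : Prop := TerminatingMod R B ∧ ChurchRosserMod R B

/-- The TRS `R` is a `B`-complete representation of the ES `E`. -/
def IsCompleteRepresentation (B R E : PairSet L V) : Prop :=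
  IsTRS R ∧ (∀ s t, Conv (E ∪ B) s t ↔ Conv (R ∪ B) s t) ∧ CompleteMod R B

/-- `gt` is a `B`-compatible reduction order. -/
structure IsCompatibleReductionOrder (B : PairSet L V) (gt : L.Term V → L.Term V → Prop) :
    Prop where
  trans : ∀ s t u, gt s t → gt t u → gt s u
  wf : WellFounded fun s t => gt t s
  closed_context : ∀ s t c p, IsPos c p → gt s t → gt (replaceAt c p s) (replaceAt c p t)
  closed_subst : ∀ (s t : L.Term V) (σ : V → L.Term V), gt s t → gt (s.subst σ) (t.subst σ)
  compatible : ∀ s s' t' t, Conv B s s' → gt s' t' → Conv B t' t → gt s t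

/-! ### Critical peaks -/

/-- `⟨l₁ → r₁, p, l₂ → r₂⟩` is an overlap of a rule from `S₁` and a rule from `S₂`. -/
def IsOverlap (S₁ S₂ : PairSet L V) (l₁ r₁ : L.Term V) (p : List ℕ) (l₂ r₂ : L.Term V) : Prop :=
  (∃ l r, (l, r) ∈ S₁ ∧ IsVariant l r l₁ r₁) ∧
  (∃ l r, (l, r) ∈ S₂ ∧ IsVariant l r l₂ r₂) ∧
  Disjoint ((vars l₁ : Set V) ∪ vars r₁) ((vars l₂ : Set V) ∪ vars r₂) ∧
  IsFunPos l₂ p ∧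
  (∃ v σ, subtermAt l₂ p = some v ∧ IsUnifier σ l₁ v) ∧
  (p = [] → ¬ IsVariant l₁ r₁ l₂ r₂)

/-- `⟨t, p, s, u⟩` is a critical peak obtained from an overlap of a rule from `S₁` and a rule
from `S₂`: the rule from `S₁` rewrites `s` at position `p` to `t`, the rule from `S₂` rewrites
`s` at the root to `u`. -/
def IsCriticalPeak (S₁ S₂ : PairSet L V) (t : L.Term V) (p : List ℕ) (s u : L.Term V) : Prop :=
  ∃ (l₁ r₁ l₂ r₂ v : L.Term V) (σ : V → L.Term V), IsOverlap S₁ S₂ l₁ r₁ p l₂ r₂ ∧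
    subtermAt l₂ p = some v ∧ IsMGU σ l₁ v ∧
    t = replaceAt (l₂.subst σ) p (r₁.subst σ) ∧ s = l₂.subst σ ∧ u = r₂.subst σ

/-- All proper subterms of `s|_p` are normal forms of `→_R`. -/
def IsPrimeAt (R : PairSet L V) (p : List ℕ) (s : L.Term V) : Prop :=
  ∀ q v, q ≠ [] → subtermAt s (p ++ q) = some v → IsNF R v

/-- The prime critical pairs of `R`. -/
def PCP (R : PairSet L V) : PairSet L V :=
  {e | ∃ p s, IsCriticalPeak R R e.1 p s e.2 ∧ IsPrimeAt R p s}

/-- The prime critical pairs between `R` and `S` and between `S` and `R`, where irreducibility is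
always checked with respect to `R`. -/
def PCPpm (R S : PairSet L V) : PairSet L V :=
  {e | ∃ p s, (IsCriticalPeak R S e.1 p s e.2 ∨ IsCriticalPeak S R e.1 p s e.2) ∧
    IsPrimeAt R p s}

/-! ### The inference system -/

/-- `Infer B gt E R E' R'` is an inference step from `(E, R)` to `(E', R')`. The side conditions
`∉` express that the unions in the premises are disjoint. -/
inductive Infer (B : PairSet L V) (gt : L.Term V → L.Term V → Prop) :
    PairSet L V → PairSet L V → PairSet L V → PairSet L V → Prop
  | deduce_peak {E R : PairSet L V} {a s t : L.Term V} :
      Rew R a s → Rew R a t → Infer B gt E R (E ∪ {(s, t)}) R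
  | deduce_cliff {E R : PairSet L V} {a s t : L.Term V} :
      Rew R a s → SymRew B a t → Infer B gt E R E (R ∪ {(t, s)})
  | orient {E R : PairSet L V} {e : L.Term V × L.Term V} {s t : L.Term V} :
      e ∉ E → e = (s, t) ∨ e = (t, s) → gt s t →
      Infer B gt (E ∪ {e}) R E (R ∪ {(s, t)})
  | delete {E R : PairSet L V} {s t : L.Term V} :
      (s, t) ∉ E → Conv B s t → Infer B gt (E ∪ {(s, t)}) R E R
  | simplify {E R : PairSet L V} {e : L.Term V × L.Term V} {s t u : L.Term V} :
      e ∉ E → e = (s, t) ∨ e = (t, s) → RewMod R B s u →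
      Infer B gt (E ∪ {e}) R (E ∪ {(u, t)}) R
  | collapse {E R : PairSet L V} {s t u : L.Term V} :
      (s, t) ∉ R → Rew R s u → Infer B gt E (R ∪ {(s, t)}) (E ∪ {(u, t)}) R
  | compose {E R : PairSet L V} {s t u : L.Term V} :
      (s, t) ∉ R → RewMod R B t u → Infer B gt E (R ∪ {(s, t)}) E (R ∪ {(s, u)})

/-- `(Es 0, Rs 0), …, (Es n, Rs n)` is a run for `E`. -/
def IsRun (B : PairSet L V) (gt : L.Term V → L.Term V → Prop) (E : PairSet L V)
    (Es Rs : ℕ → PairSet L V) (n : ℕ) : Prop :=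
  Es 0 = E ∧ Rs 0 = ∅ ∧ ∀ i < n, Infer B gt (Es i) (Rs i) (Es (i + 1)) (Rs (i + 1))

/-- The run `(Es 0, Rs 0), …, (Es n, Rs n)` fails. -/
def Fails (Es : ℕ → PairSet L V) (n : ℕ) : Prop := Es n ≠ ∅

/-- The run `(Es 0, Rs 0), …, (Es n, Rs n)` is fair. -/
def IsFair (B : PairSet L V) (Es Rs : ℕ → PairSet L V) (n : ℕ) : Prop :=
  IsLeftLinear (Rs n) ∧
  (∀ t u, (t, u) ∈ PCP (Rs n) →
    Valley (Rs n) B t u ∨ ∃ i ≤ n, SymRew (Es i ∪ Rs i) t u) ∧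
  (∀ t u, (t, u) ∈ PCPpm (Rs n) (symmPairs B) →
    Valley (Rs n) B t u ∨ ∃ i ≤ n, SymRew (Rs i) t u)

end TRS

/-! Every rule that occurs in the run decreases in `gt`: oriented rules do so by their side
condition, deduced and composed rules by compatibility with `∼` and transitivity. A reduction order
relates only a non-variable to a term without new variables, so the final rules form a TRS.
Rewriting modulo `B` is contained in `gt`, so it terminates.

Inference steps add only consequences (`Infer.conv_of_mem`). Conversely, a pair that a step removes
is replaceable by a conversion in the later system. Going backwards from the end of the run, where
no equations are left, this replaces every earlier step by a conversion with the final rules and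
`B`. `Simulates` records in addition that the conversion stays inside any set of terms that contains
both ends and is closed under `gt` and `∼`.

For Church-Rosser modulo `B`, the criterion is `churchRosserMod_of_local`. A peak `t ← s → u` needs
a conversion through terms below `s`. For a cliff `t ← s ↔ u` with a `B`-step this is too much to
ask, since `u ∼ s` is not below `s`; instead there must be a rewrite step `u → v` and a conversion
below `s` from `v` to `t`. Well-founded induction then shows that normal forms of convertible terms
are `B`-equivalent.

By `peak_cases` and `cliff_cases` only prime overlaps matter: if the redex of the lower step has a
reducible proper subterm, a prime step from `s` inside that redex cuts the peak or cliff in two.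
Fairness leaves valleys or steps of the run. For peaks, `Simulates` below `s` turns such steps into
the required conversions. For cliffs, fairness admits only rules, and `SimulatesRules` turns a rule
step from `u` into a final rewrite step followed by a conversion below `u`, hence below `s`. -/

namespace TRS

open FirstOrder FirstOrder.Language

variable {L : FirstOrder.Language.{u, v}} {V : Type w}

/-! ### Variables, subterms and replacement -/

@[simp]
theorem mem_vars_var {x y : V} : x ∈ vars (Term.var y : L.Term V) ↔ x = y := by
  simp [vars]

@[simp]
theorem mem_vars_func {x : V} {k : ℕ} {f : L.Functions k} {ts : Fin k → L.Term V} :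
    x ∈ vars (Term.func f ts) ↔ ∃ i, x ∈ vars (ts i) := by
  simp [vars]

theorem subst_congr {σ τ : V → L.Term V} {t : L.Term V} (h : ∀ x ∈ vars t, σ x = τ x) :
    t.subst σ = t.subst τ := by
  induction t with
  | var x => simpa using h
  | func f ts ih =>
    simp only [Term.subst]
    congr 1
    funext i
    exact ih i fun x hx => h x (mem_vars_func.2 ⟨i, hx⟩)

theorem subst_subst (σ τ : V → L.Term V) (t : L.Term V) :
    (t.subst σ).subst τ = t.subst fun x => (σ x).subst τ := by
  induction t with
  | var x => rfl
  | func f ts ih => simp [ih]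

@[simp]
theorem subst_var (t : L.Term V) : t.subst Term.var = t := by
  induction t with
  | var x => rfl
  | func f ts ih => simp [ih]

theorem relabel_eq_subst (g : V → V) (t : L.Term V) :
    t.relabel g = t.subst fun x => Term.var (g x) := by
  induction t with
  | var x => rfl
  | func f ts ih => simp [ih]

theorem mem_vars_subst {σ : V → L.Term V} {t : L.Term V} {x : V} :
    x ∈ vars (t.subst σ) ↔ ∃ y ∈ vars t, x ∈ vars (σ y) := by
  induction t with
  | var y => simp
  | func f ts ih =>
    simp only [Term.subst, mem_vars_func, ih]
    constructor
    · rintro ⟨i, y, hy, hx⟩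
      exact ⟨y, ⟨i, hy⟩, hx⟩
    · rintro ⟨y, ⟨i, hy⟩, hx⟩
      exact ⟨i, y, hy, hx⟩

theorem mem_vars_relabel {g : V → V} {t : L.Term V} {x : V} :
    x ∈ vars (t.relabel g) ↔ ∃ y ∈ vars t, x = g y := by
  simp [relabel_eq_subst, mem_vars_subst]

@[simp]
theorem subtermAt_nil (t : L.Term V) : subtermAt t [] = some t := by
  cases t <;> simp [subtermAt]

@[simp]
theorem subtermAt_var_cons (x : V) (i : ℕ) (p : List ℕ) :
    subtermAt (Term.var x : L.Term V) (i :: p) = none := by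
  simp [subtermAt]

theorem subtermAt_func_cons {k : ℕ} (f : L.Functions k) (ts : Fin k → L.Term V) (i : ℕ)
    (p : List ℕ) :
    subtermAt (Term.func f ts) (i :: p) =
      if h : i < k then subtermAt (ts ⟨i, h⟩) p else none := by
  simp [subtermAt]

@[simp]
theorem subtermAt_func_cons_fin {k : ℕ} (f : L.Functions k) (ts : Fin k → L.Term V) (i : Fin k)
    (p : List ℕ) : subtermAt (Term.func f ts) ((i : ℕ) :: p) = subtermAt (ts i) p := by
  simp [subtermAt_func_cons]

theorem subtermAt_func_cons_eq_some {k : ℕ} {f : L.Functions k} {ts : Fin k → L.Term V} {i : ℕ}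
    {p : List ℕ} {u : L.Term V} :
    subtermAt (Term.func f ts) (i :: p) = some u ↔
      ∃ j : Fin k, (j : ℕ) = i ∧ subtermAt (ts j) p = some u := by
  rw [subtermAt_func_cons]
  constructor
  · intro h
    split_ifs at h with hi
    exact ⟨⟨i, hi⟩, rfl, h⟩
  · rintro ⟨j, rfl, h⟩
    simpa using h

@[simp]
theorem replaceAt_nil (t w : L.Term V) : replaceAt t [] w = w := by
  cases t <;> simp [replaceAt]

@[simp]
theorem replaceAt_var_cons (x : V) (i : ℕ) (p : List ℕ) (w : L.Term V) :
    replaceAt (Term.var x : L.Term V) (i :: p) w = Term.var x := by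
  simp [replaceAt]

@[simp]
theorem replaceAt_func_cons {k : ℕ} (f : L.Functions k) (ts : Fin k → L.Term V) (i : ℕ)
    (p : List ℕ) (w : L.Term V) :
    replaceAt (Term.func f ts) (i :: p) w =
      Term.func f fun j => if (j : ℕ) = i then replaceAt (ts j) p w else ts j := by
  simp [replaceAt]

theorem replaceAt_func_cons_fin {k : ℕ} (f : L.Functions k) (ts : Fin k → L.Term V) (i : Fin k)
    (p : List ℕ) (w : L.Term V) :
    replaceAt (Term.func f ts) ((i : ℕ) :: p) w =
      Term.func f (Function.update ts i (replaceAt (ts i) p w)) := by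
  rw [replaceAt_func_cons]
  congr 1
  funext j
  by_cases h : j = i
  · subst h; simp
  · simp [h, Fin.val_inj]

theorem subtermAt_append {t u : L.Term V} {p : List ℕ} (h : subtermAt t p = some u)
    (q : List ℕ) : subtermAt t (p ++ q) = subtermAt u q := by
  induction t generalizing p with
  | var x =>
    cases p with
    | nil => simp_all
    | cons i p => simp at h
  | func f ts ih =>
    cases p with
    | nil => simp_all
    | cons i p =>
      obtain ⟨j, rfl, hj⟩ := subtermAt_func_cons_eq_some.1 h
      simpa using ih j hj

theorem replaceAt_append {t u : L.Term V} {p : List ℕ} (h : subtermAt t p = some u)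
    (q : List ℕ) (w : L.Term V) :
    replaceAt t (p ++ q) w = replaceAt t p (replaceAt u q w) := by
  induction t generalizing p with
  | var x =>
    cases p with
    | nil => simp_all
    | cons i p => simp at h
  | func f ts ih =>
    cases p with
    | nil => simp_all
    | cons i p =>
      obtain ⟨j, rfl, hj⟩ := subtermAt_func_cons_eq_some.1 h
      simp only [List.cons_append, replaceAt_func_cons_fin, ih j hj]

theorem subtermAt_replaceAt {t : L.Term V} {p : List ℕ} (h : IsPos t p) (w : L.Term V) :
    subtermAt (replaceAt t p w) p = some w := by
  obtain ⟨u, h⟩ := h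
  induction t generalizing p with
  | var x =>
    cases p with
    | nil => simp
    | cons i p => simp at h
  | func f ts ih =>
    cases p with
    | nil => simp
    | cons i p =>
      obtain ⟨j, rfl, hj⟩ := subtermAt_func_cons_eq_some.1 h
      simpa [replaceAt_func_cons_fin] using ih j hj

@[simp]
theorem replaceAt_replaceAt (t : L.Term V) (p : List ℕ) (a b : L.Term V) :
    replaceAt (replaceAt t p a) p b = replaceAt t p b := by
  induction t generalizing p with
  | var x => cases p <;> simp
  | func f ts ih =>
    cases p with
    | nil => simp
    | cons i p =>
      simp only [replaceAt_func_cons]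
      congr 1
      funext j
      split_ifs <;> simp [ih]

theorem replaceAt_self {t u : L.Term V} {p : List ℕ} (h : subtermAt t p = some u) :
    replaceAt t p u = t := by
  induction t generalizing p with
  | var x => cases p <;> simp_all
  | func f ts ih =>
    cases p with
    | nil => simp_all
    | cons i p =>
      obtain ⟨j, rfl, hj⟩ := subtermAt_func_cons_eq_some.1 h
      rw [replaceAt_func_cons_fin, ih j hj, Function.update_eq_self]

theorem subtermAt_subst {t u : L.Term V} {p : List ℕ} (h : subtermAt t p = some u)
    (σ : V → L.Term V) : subtermAt (t.subst σ) p = some (u.subst σ) := by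
  induction t generalizing p with
  | var x => 
    cases p with
    | nil => obtain rfl : Term.var x = u := by simpa using h
             simp
    | cons i p => simp at h
  | func f ts ih =>
    cases p with
    | nil =>
      obtain rfl : Term.func f ts = u := by simpa using h
      simp
    | cons i p =>
      obtain ⟨j, rfl, hj⟩ := subtermAt_func_cons_eq_some.1 h
      simpa using ih j hj

theorem replaceAt_subst {t : L.Term V} {p : List ℕ} (h : IsPos t p) (w : L.Term V)
    (σ : V → L.Term V) :
    (replaceAt t p w).subst σ = replaceAt (t.subst σ) p (w.subst σ) := by
  obtain ⟨u, h⟩ := h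
  induction t generalizing p with
  | var x => cases p <;> simp_all
  | func f ts ih =>
    cases p with
    | nil => simp_all
    | cons i p =>
      obtain ⟨j, rfl, hj⟩ := subtermAt_func_cons_eq_some.1 h
      simp only [replaceAt_func_cons, Term.subst]
      congr 1
      funext k
      split_ifs with hk
      · rw [← ih k (by rwa [Fin.val_inj.1 hk])]
      · rfl

theorem subtermAt_replaceAt_parallel {t : L.Term V} {p q : List ℕ} (hpq : ¬ p <+: q)
    (hqp : ¬ q <+: p) (w : L.Term V) : subtermAt (replaceAt t p w) q = subtermAt t q := by
  induction t generalizing p q with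
  | var x => cases p <;> simp_all
  | func f ts ih =>
    cases p with
    | nil => simp at hpq
    | cons i p =>
      cases q with
      | nil => simp at hqp
      | cons j q =>
        simp only [replaceAt_func_cons, subtermAt_func_cons]
        split_ifs with h₁ h₂
        · obtain rfl : j = i := h₂
          exact ih _ (by simpa using hpq) (by simpa using hqp)
        · rfl
        · rfl

theorem replaceAt_comm_parallel {t : L.Term V} {p q : List ℕ} (hpq : ¬ p <+: q)
    (hqp : ¬ q <+: p) (a b : L.Term V) :
    replaceAt (replaceAt t p a) q b = replaceAt (replaceAt t q b) p a := by
  induction t generalizing p q with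
  | var x => cases p <;> cases q <;> simp_all
  | func f ts ih =>
    cases p with
    | nil => simp at hpq
    | cons i p =>
      cases q with
      | nil => simp at hqp
      | cons j q =>
        simp only [replaceAt_func_cons]
        congr 1
        funext k
        split_ifs with h₁ h₂
        · obtain rfl : j = i := h₁.symm.trans h₂
          exact ih _ (by simpa using hpq) (by simpa using hqp)
        · rfl
        · rfl
        · rfl

theorem vars_subset_of_subtermAt {t u : L.Term V} {p : List ℕ} (h : subtermAt t p = some u) :
    vars u ⊆ vars t := by
  induction t generalizing p with
  | var x => cases p <;> simp_all
  | func f ts ih =>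
    cases p with
    | nil => simp_all
    | cons i p =>
      obtain ⟨j, rfl, hj⟩ := subtermAt_func_cons_eq_some.1 h
      exact fun x hx => mem_vars_func.2 ⟨j, ih j hj hx⟩

theorem exists_subtermAt_of_mem_vars {t : L.Term V} {x : V} (h : x ∈ vars t) :
    ∃ p, subtermAt t p = some (.var x) := by
  induction t with
  | var y => exact ⟨[], by simp_all⟩
  | func f ts ih =>
    obtain ⟨i, hi⟩ := mem_vars_func.1 h
    obtain ⟨p, hp⟩ := ih i hi
    exact ⟨(i : ℕ) :: p, by simpa using hp⟩

/-- A position of `t.subst τ` is a function symbol position of `t`, or it is below a variable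
position of `t`. -/
theorem subtermAt_subst_cases {t w : L.Term V} {τ : V → L.Term V} {p : List ℕ}
    (h : subtermAt (t.subst τ) p = some w) :
    (∃ v, IsFunPos t p ∧ subtermAt t p = some v ∧ w = v.subst τ) ∨
      ∃ p₁ p₂ x, p = p₁ ++ p₂ ∧ subtermAt t p₁ = some (.var x) ∧
        subtermAt (τ x) p₂ = some w := by
  induction t generalizing p with
  | var x => exact .inr ⟨[], p, x, by simp, by simp, h⟩
  | @func k f ts ih =>
    cases p with
    | nil =>
      refine .inl ⟨Term.func f ts, ⟨k, f, ts, by simp⟩, by simp, ?_⟩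
      simpa using h.symm
    | cons i p =>
      obtain ⟨j, rfl, hj⟩ := subtermAt_func_cons_eq_some.1 h
      rcases ih j hj with ⟨v, ⟨m, g, us, hf⟩, hv, hw⟩ | ⟨p₁, p₂, x, rfl, h₁, h₂⟩
      · exact .inl ⟨v, ⟨m, g, us, by simpa using hf⟩, by simpa using hv, hw⟩
      · exact .inr ⟨(j : ℕ) :: p₁, p₂, x, by simp, by simpa using h₁, h₂⟩

/-! ### Closure properties of rewriting -/

/-- `s →_E t` by a step at position `p`. -/
def RewAt (E : PairSet L V) (p : List ℕ) (s t : L.Term V) : Prop :=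
  ∃ (l r : L.Term V) (σ : V → L.Term V), (l, r) ∈ E ∧
    subtermAt s p = some (l.subst σ) ∧ t = replaceAt s p (r.subst σ)

theorem rew_iff_exists_rewAt {E : PairSet L V} {s t : L.Term V} :
    Rew E s t ↔ ∃ p, RewAt E p s t := by
  constructor
  · rintro ⟨l, r, p, σ, h⟩
    exact ⟨p, l, r, σ, h⟩
  · rintro ⟨p, l, r, σ, h⟩
    exact ⟨l, r, p, σ, h⟩

theorem RewAt.rew {E : PairSet L V} {p : List ℕ} {s t : L.Term V} (h : RewAt E p s t) :
    Rew E s t :=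
  rew_iff_exists_rewAt.2 ⟨p, h⟩

theorem Rew.mono {E F : PairSet L V} (hEF : E ⊆ F) {s t : L.Term V} (h : Rew E s t) :
    Rew F s t := by
  obtain ⟨l, r, p, σ, hlr, h⟩ := h
  exact ⟨l, r, p, σ, hEF hlr, h⟩

theorem rew_of_mem {E : PairSet L V} {l r : L.Term V} (h : (l, r) ∈ E) : Rew E l r :=
  ⟨l, r, [], Term.var, h, by simp, by simp⟩

theorem RewAt.context {E : PairSet L V} {p : List ℕ} {s t : L.Term V} (h : RewAt E p s t)
    {c : L.Term V} {q : List ℕ} (hc : IsPos c q) :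
    RewAt E (q ++ p) (replaceAt c q s) (replaceAt c q t) := by
  obtain ⟨l, r, σ, hlr, hs, rfl⟩ := h
  have hq := subtermAt_replaceAt hc s
  refine ⟨l, r, σ, hlr, by rw [subtermAt_append hq, hs], ?_⟩
  rw [replaceAt_append hq, replaceAt_replaceAt]

/-- A step at or below position `q` is a step in the subterm at `q`. -/
theorem RewAt.exists_subterm {E : PairSet L V} {q p : List ℕ} {s t s₀ : L.Term V}
    (h : RewAt E (q ++ p) s t) (hs₀ : subtermAt s q = some s₀) :
    ∃ t₀, RewAt E p s₀ t₀ ∧ t = replaceAt s q t₀ := by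
  obtain ⟨l, r, σ, hlr, hs, rfl⟩ := h
  rw [subtermAt_append hs₀] at hs
  exact ⟨_, ⟨l, r, σ, hlr, hs, rfl⟩, replaceAt_append hs₀ _ _⟩

theorem RewAt.isPos {E : PairSet L V} {p : List ℕ} {s t : L.Term V} (h : RewAt E p s t) :
    IsPos s p := by
  obtain ⟨l, r, σ, -, hs, -⟩ := h
  exact ⟨_, hs⟩

/-- The relation `r` is closed under contexts. -/
def ContextClosed (r : L.Term V → L.Term V → Prop) : Prop :=
  ∀ ⦃s t⦄, r s t → ∀ ⦃c p⦄, IsPos c p → r (replaceAt c p s) (replaceAt c p t)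

/-- The relation `r` is closed under substitutions. -/
def SubstClosed (r : L.Term V → L.Term V → Prop) : Prop :=
  ∀ ⦃s t⦄, r s t → ∀ σ : V → L.Term V, r (s.subst σ) (t.subst σ)

theorem contextClosed_reflTransGen {r : L.Term V → L.Term V → Prop} (hr : ContextClosed r) :
    ContextClosed (Relation.ReflTransGen r) := by
  intro s t h c p hc
  exact Relation.ReflTransGen.lift (replaceAt c p) (fun _ _ h => hr h hc) _ _ h

theorem substClosed_reflTransGen {r : L.Term V → L.Term V → Prop} (hr : SubstClosed r) :
    SubstClosed (Relation.ReflTransGen r) := by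
  intro s t h σ
  exact Relation.ReflTransGen.lift (fun a => Term.subst a σ) (fun _ _ h => hr h σ) _ _ h

theorem contextClosed_rew (E : PairSet L V) : ContextClosed (Rew E) := by
  intro s t h c p hc
  obtain ⟨q, h⟩ := rew_iff_exists_rewAt.1 h
  exact (h.context hc).rew

theorem substClosed_rew (E : PairSet L V) : SubstClosed (Rew E) := by
  rintro s t ⟨l, r, p, σ, hlr, hs, rfl⟩ τ
  refine ⟨l, r, p, fun x => (σ x).subst τ, hlr, ?_, ?_⟩
  · rw [subtermAt_subst hs τ, subst_subst]
  · rw [replaceAt_subst ⟨_, hs⟩, subst_subst]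

theorem contextClosed_symRew (E : PairSet L V) : ContextClosed (SymRew E) := fun _ _ h _ _ hc =>
  h.imp (fun h => contextClosed_rew E h hc) fun h => contextClosed_rew E h hc

theorem substClosed_symRew (E : PairSet L V) : SubstClosed (SymRew E) := fun _ _ h σ =>
  h.imp (fun h => substClosed_rew E h σ) fun h => substClosed_rew E h σ

theorem contextClosed_conv (E : PairSet L V) : ContextClosed (Conv E) :=
  contextClosed_reflTransGen (contextClosed_symRew E)

theorem substClosed_conv (E : PairSet L V) : SubstClosed (Conv E) :=
  substClosed_reflTransGen (substClosed_symRew E)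

theorem contextClosed_valley (R B : PairSet L V) : ContextClosed (Valley R B) := by
  rintro s t ⟨s', t', hs, h, ht⟩ c p hc
  have hR := contextClosed_reflTransGen (contextClosed_rew R)
  exact ⟨_, _, hR hs hc, contextClosed_conv B h hc, hR ht hc⟩

theorem substClosed_valley (R B : PairSet L V) : SubstClosed (Valley R B) := by
  rintro s t ⟨s', t', hs, h, ht⟩ σ
  have hR := substClosed_reflTransGen (substClosed_rew R)
  exact ⟨_, _, hR hs σ, substClosed_conv B h σ, hR ht σ⟩

theorem SymRew.symm {E : PairSet L V} {s t : L.Term V} (h : SymRew E s t) : SymRew E t s :=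
  Or.symm h

theorem SymRew.mono {E F : PairSet L V} (hEF : E ⊆ F) {s t : L.Term V} (h : SymRew E s t) :
    SymRew F s t :=
  h.imp (Rew.mono hEF) (Rew.mono hEF)

theorem Conv.refl (E : PairSet L V) (s : L.Term V) : Conv E s s :=
  Relation.ReflTransGen.refl

theorem Conv.symm {E : PairSet L V} {s t : L.Term V} (h : Conv E s t) : Conv E t s :=
  haveI : Std.Symm (SymRew E) := ⟨fun _ _ => SymRew.symm⟩
  Relation.ReflTransGen.stdSymm.symm _ _ h

theorem Conv.trans {E : PairSet L V} {s t u : L.Term V} (h : Conv E s t) (h' : Conv E t u) :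
    Conv E s u :=
  Relation.ReflTransGen.trans h h'

theorem SymRew.conv {E : PairSet L V} {s t : L.Term V} (h : SymRew E s t) : Conv E s t :=
  .single h

theorem Rew.conv {E : PairSet L V} {s t : L.Term V} (h : Rew E s t) : Conv E s t :=
  .single (.inl h)

theorem Conv.mono {E F : PairSet L V} (hEF : E ⊆ F) {s t : L.Term V} (h : Conv E s t) :
    Conv F s t :=
  Relation.ReflTransGen.mono (fun _ _ => SymRew.mono hEF) _ _ h

/-- If every pair of `E` is in a relation closed under contexts and substitutions, then so is
every rewrite step. -/
theorem Rew.of_closed {E : PairSet L V} {rel : L.Term V → L.Term V → Prop}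
    (hc : ContextClosed rel) (hσ : SubstClosed rel) (hE : ∀ l r, (l, r) ∈ E → rel l r)
    {s t : L.Term V} (h : Rew E s t) : rel s t := by
  obtain ⟨l, r, p, σ, hlr, hs, rfl⟩ := h
  have := hc (hσ (hE l r hlr) σ) (c := s) (p := p) ⟨_, hs⟩
  rwa [replaceAt_self hs] at this

theorem Conv.of_pairs {E F : PairSet L V} (h : ∀ l r, (l, r) ∈ E → Conv F l r) {s t : L.Term V}
    (hst : Conv E s t) : Conv F s t := by
  have hrew : ∀ {a b}, Rew E a b → Conv F a b :=
    Rew.of_closed (contextClosed_conv F) (substClosed_conv F) h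
  induction hst with
  | refl => exact Conv.refl _ _
  | tail _ h ih => exact ih.trans (h.elim hrew fun h => (hrew h).symm)

theorem Valley.symm {R B : PairSet L V} {s t : L.Term V} (h : Valley R B s t) :
    Valley R B t s := by
  obtain ⟨s', t', hs, h, ht⟩ := h
  exact ⟨t', s', ht, h.symm, hs⟩

theorem rewAt_symmPairs {E : PairSet L V} {p : List ℕ} {s t : L.Term V} :
    RewAt (symmPairs E) p s t ↔ RewAt E p s t ∨ RewAt E p t s := by
  constructor
  · rintro ⟨l, r, σ, hlr, hs, rfl⟩
    rcases hlr with hlr | hlr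
    · exact .inl ⟨l, r, σ, hlr, hs, rfl⟩
    · refine .inr ⟨r, l, σ, hlr, subtermAt_replaceAt ⟨_, hs⟩ _, ?_⟩
      rw [replaceAt_replaceAt, replaceAt_self hs]
  · rintro (⟨l, r, σ, hlr, hs, rfl⟩ | ⟨l, r, σ, hlr, hs, rfl⟩)
    · exact ⟨l, r, σ, .inl hlr, hs, rfl⟩
    · refine ⟨r, l, σ, .inr hlr, subtermAt_replaceAt ⟨_, hs⟩ _, ?_⟩
      rw [replaceAt_replaceAt, replaceAt_self hs]

theorem symRew_iff_exists_rewAt {E : PairSet L V} {s t : L.Term V} :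
    SymRew E s t ↔ ∃ p, RewAt (symmPairs E) p s t := by
  simp only [SymRew, rew_iff_exists_rewAt, rewAt_symmPairs, exists_or]

theorem RewAt.symRew {E : PairSet L V} {p : List ℕ} {s t : L.Term V}
    (h : RewAt (symmPairs E) p s t) : SymRew E s t :=
  symRew_iff_exists_rewAt.2 ⟨p, h⟩

/-- Steps at parallel positions commute. -/
theorem RewAt.commute {E F : PairSet L V} {p q : List ℕ} {s t u : L.Term V} (hpq : ¬ p <+: q)
    (hqp : ¬ q <+: p) (ht : RewAt E p s t) (hu : RewAt F q s u) :
    ∃ v, RewAt F q t v ∧ RewAt E p u v := by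
  obtain ⟨l, r, σ, hlr, hs, rfl⟩ := ht
  obtain ⟨l', r', σ', hlr', hs', rfl⟩ := hu
  refine ⟨_, ⟨l', r', σ', hlr', ?_, rfl⟩, ⟨l, r, σ, hlr, ?_, ?_⟩⟩
  · rw [subtermAt_replaceAt_parallel hpq hqp, hs']
  · rw [subtermAt_replaceAt_parallel hqp hpq, hs]
  · rw [replaceAt_comm_parallel hpq hqp]

/-! ### Steps below variable positions -/

/-- A reflexive, transitive relation closed under contexts is closed under function symbols. -/
theorem reflTransGen_func {r : L.Term V → L.Term V → Prop} (hr : ContextClosed r) {k : ℕ}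
    (f : L.Functions k) {ts us : Fin k → L.Term V}
    (h : ∀ i, Relation.ReflTransGen r (ts i) (us i)) :
    Relation.ReflTransGen r (Term.func f ts) (Term.func f us) := by
  -- The arguments are changed one after the other; `S` holds the indices already treated.
  have key : ∀ S : Finset (Fin k), Relation.ReflTransGen r (Term.func f ts)
      (Term.func f fun i => if i ∈ S then us i else ts i) := by
    intro S
    induction S using Finset.induction_on with
    | empty => simpa using Relation.ReflTransGen.refl
    | insert a S ha ih =>
      refine ih.trans ?_
      set vs : Fin k → L.Term V := fun i => if i ∈ S then us i else ts i
      have hpos : IsPos (Term.func f vs) [(a : ℕ)] := ⟨vs a, by simp⟩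
      have := contextClosed_reflTransGen hr (h a) hpos
      simp only [replaceAt_func_cons_fin, replaceAt_nil] at this
      convert this using 2
      · rw [eq_comm, Function.update_eq_self_iff]
        simp [vs, ha]
      · funext i
        by_cases hi : i = a
        · subst hi; simp
        · simp [hi, vs]
  simpa using key Finset.univ

theorem reflTransGen_subst {r : L.Term V → L.Term V → Prop} (hr : ContextClosed r)
    {τ τ' : V → L.Term V} (h : ∀ x, Relation.ReflTransGen r (τ x) (τ' x)) (t : L.Term V) :
    Relation.ReflTransGen r (t.subst τ) (t.subst τ') := by
  induction t with
  | var x => exact h x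
  | func f ts ih => exact reflTransGen_func hr f ih

/-- Used for variable overlaps: once one occurrence of `x` has been rewritten, the remaining
occurrences can catch up, so that an instance of `t` is reached again. -/
theorem reflTransGen_replaceAt_subst {r : L.Term V → L.Term V → Prop} (hr : ContextClosed r)
    {τ τ' : V → L.Term V} (h : ∀ x, Relation.ReflTransGen r (τ x) (τ' x)) {t : L.Term V}
    {p : List ℕ} {x : V} (hp : subtermAt t p = some (.var x)) :
    Relation.ReflTransGen r (replaceAt (t.subst τ) p (τ' x)) (t.subst τ') := by
  induction t generalizing p with
  | var y =>
    cases p with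
    | nil =>
      obtain rfl : y = x := by simpa using hp
      simpa using Relation.ReflTransGen.refl
    | cons i p => simp at hp
  | func f ts ih =>
    cases p with
    | nil => simp at hp
    | cons i p =>
      obtain ⟨j, rfl, hj⟩ := subtermAt_func_cons_eq_some.1 hp
      simp only [Term.subst, replaceAt_func_cons]
      refine reflTransGen_func hr f fun k => ?_
      split_ifs with hk
      · obtain rfl := Fin.val_inj.1 hk
        exact ih k hj
      · exact reflTransGen_subst hr h _

/-- With a single occurrence of `x` there is nothing to catch up. A `B`-step below a variable of a
linear left-hand side therefore leaves a redex immediately. -/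
theorem replaceAt_subst_of_unique {τ τ' : V → L.Term V} {t : L.Term V} {p : List ℕ} {x : V}
    (h : ∀ y, y ≠ x → τ y = τ' y) (hp : subtermAt t p = some (.var x))
    (huniq : ∀ q, subtermAt t q = some (.var x) → q = p) :
    replaceAt (t.subst τ) p (τ' x) = t.subst τ' := by
  induction t generalizing p with
  | var y =>
    cases p with
    | nil =>
      obtain rfl : y = x := by simpa using hp
      simp
    | cons i p => simp at hp
  | func f ts ih =>
    cases p with
    | nil => simp at hp
    | cons i p =>
      obtain ⟨j, rfl, hj⟩ := subtermAt_func_cons_eq_some.1 hp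
      simp only [Term.subst, replaceAt_func_cons]
      congr 1
      funext k
      split_ifs with hk
      · obtain rfl := Fin.val_inj.1 hk
        refine ih k hj fun q hq => ?_
        simpa using huniq ((k : ℕ) :: q) (by simpa using hq)
      · refine subst_congr fun y hy => h y ?_
        rintro rfl
        obtain ⟨q, hq⟩ := exists_subtermAt_of_mem_vars hy
        have := huniq ((k : ℕ) :: q) (by simpa using hq)
        exact hk (List.cons.inj this).1

/-! ### Most general unifiers -/

/-- The number of symbols of a term. -/
def size : L.Term V → ℕ
  | .var _ => 1
  | .func _ ts => 1 + ∑ i, size (ts i)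

theorem size_le_size_subst {t : L.Term V} {x : V} (h : x ∈ vars t) (τ : V → L.Term V) :
    size (τ x) ≤ size (t.subst τ) := by
  induction t with
  | var y =>
    obtain rfl := mem_vars_var.1 h
    exact le_rfl
  | func f ts ih =>
    obtain ⟨i, hi⟩ := mem_vars_func.1 h
    have h₁ := ih i hi
    have h₂ := Finset.single_le_sum (f := fun j => size ((ts j).subst τ))
      (fun _ _ => Nat.zero_le _) (Finset.mem_univ i)
    simp only [Term.subst, size]
    omega

/-- The occurs check: the right side is strictly larger, as it contains `τ x` below a function
symbol. -/
theorem subst_ne_of_mem_vars {k : ℕ} {f : L.Functions k} {ts : Fin k → L.Term V} {x : V}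
    (h : x ∈ vars (Term.func f ts)) (τ : V → L.Term V) : τ x ≠ (Term.func f ts).subst τ := by
  intro heq
  obtain ⟨i, hi⟩ := mem_vars_func.1 h
  have h₁ := size_le_size_subst hi τ
  have h₂ := Finset.single_le_sum (f := fun j => size ((ts j).subst τ))
    (fun _ _ => Nat.zero_le _) (Finset.mem_univ i)
  have h₃ := congrArg size heq
  simp only [Term.subst, size] at h₃
  omega

/-- `σ` unifies all pairs of the list `l`. -/
def Unifies (σ : V → L.Term V) (l : List (L.Term V × L.Term V)) : Prop :=
  ∀ e ∈ l, IsUnifier σ e.1 e.2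

open Classical in
/-- The variables of a list of pairs of terms. -/
noncomputable def listVars : List (L.Term V × L.Term V) → Finset V
  | [] => ∅
  | e :: l => (vars e.1 ∪ vars e.2) ∪ listVars l

theorem mem_listVars {l : List (L.Term V × L.Term V)} {x : V} :
    x ∈ listVars l ↔ ∃ e ∈ l, x ∈ vars e.1 ∨ x ∈ vars e.2 := by
  induction l with
  | nil => simp [listVars]
  | cons e l ih => simp [listVars, ih, or_assoc]

/-- The number of symbols of a list of pairs of terms. -/
def listSize (l : List (L.Term V × L.Term V)) : ℕ :=
  (l.map fun e => size e.1 + size e.2).sum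

open Classical in
/-- The substitution that maps `x` to `t`. -/
noncomputable def single (x : V) (t : L.Term V) : V → L.Term V :=
  Function.update Term.var x t

theorem subst_single_of_notMem {x : V} {t u : L.Term V} (h : x ∉ vars u) :
    u.subst (single x t) = u := by
  classical
  conv_rhs => rw [← subst_var u]
  refine subst_congr fun y hy => ?_
  rw [single, Function.update_of_ne]
  rintro rfl
  exact h hy

theorem single_subst {x : V} {t : L.Term V} {τ : V → L.Term V} (h : τ x = t.subst τ) (y : V) :
    (single x t y).subst τ = τ y := by
  by_cases hy : y = x
  · subst hy; simp [single, h]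
  · simp [single, hy]

theorem subst_single_subst {x : V} {t : L.Term V} {τ : V → L.Term V} (h : τ x = t.subst τ)
    (u : L.Term V) : (u.subst (single x t)).subst τ = u.subst τ := by
  rw [subst_subst]
  exact subst_congr fun y _ => single_subst h y

open Classical in
/-- Elimination of a variable in a list of equations. -/
theorem exists_mgu_of_eliminate {x : V} {t : L.Term V} {l : List (L.Term V × L.Term V)}
    (hx : x ∉ vars t) {τ₀ : V → L.Term V} (h₀ : τ₀ x = t.subst τ₀) (hl : Unifies τ₀ l)
    (ih : ∀ l' : List (L.Term V × L.Term V),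
      listVars l' ⊆ (listVars ((Term.var x, t) :: l)).erase x → (∃ τ, Unifies τ l') →
      ∃ σ, Unifies σ l' ∧ ∀ τ, Unifies τ l' → ∀ x, τ x = (σ x).subst τ) :
    ∃ σ : V → L.Term V, (σ x = t.subst σ ∧ Unifies σ l) ∧
      ∀ τ : V → L.Term V, τ x = t.subst τ → Unifies τ l → ∀ x, τ x = (σ x).subst τ := by
  set ρ := single x t
  set l' := l.map fun e => (e.1.subst ρ, e.2.subst ρ)
  have hunif : ∀ τ : V → L.Term V, τ x = t.subst τ → Unifies τ l → Unifies τ l' := by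
    intro τ hτ hτl e he
    obtain ⟨e', he', rfl⟩ := List.mem_map.1 he
    have := hτl e' he'
    simpa only [IsUnifier, ρ, subst_single_subst hτ] using this
  have hvars : ∀ u : L.Term V, ∀ y ∈ vars (u.subst ρ), y ≠ x ∧ (y ∈ vars u ∨ y ∈ vars t) := by
    intro u y hy
    obtain ⟨z, hz, hy⟩ := mem_vars_subst.1 hy
    by_cases hzx : z = x
    · subst hzx
      have hy : y ∈ vars t := by simpa [ρ, single] using hy
      exact ⟨fun h => hx (h ▸ hy), .inr hy⟩
    · have hy : y = z := by simpa [ρ, single, hzx] using hy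
      subst hy
      exact ⟨hzx, .inl hz⟩
  obtain ⟨σ, hσ, hmg⟩ := ih l' (by
    intro y hy
    obtain ⟨e, he, hy⟩ := mem_listVars.1 hy
    obtain ⟨e', he', rfl⟩ := List.mem_map.1 he
    rw [Finset.mem_erase, mem_listVars]
    have key : ∀ u : L.Term V, y ∈ vars (u.subst ρ) → (u = e'.1 ∨ u = e'.2) →
        y ≠ x ∧ ∃ e ∈ (Term.var x, t) :: l, y ∈ vars e.1 ∨ y ∈ vars e.2 := by
      intro u hu hue
      refine ⟨(hvars u y hu).1, ?_⟩
      rcases (hvars u y hu).2 with h | h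
      · refine ⟨e', List.mem_cons_of_mem _ he', ?_⟩
        rcases hue with rfl | rfl
        · exact .inl h
        · exact .inr h
      · exact ⟨_, List.mem_cons_self, .inr h⟩
    rcases hy with hy | hy
    · exact key _ hy (.inl rfl)
    · exact key _ hy (.inr rfl)) ⟨τ₀, hunif τ₀ h₀ hl⟩
  -- The unifier first eliminates `x` and then solves the remaining equations.
  refine ⟨fun y => (ρ y).subst σ, ⟨?_, ?_⟩, ?_⟩
  · rw [← subst_subst, subst_single_of_notMem hx]
    simp [ρ, single]
  · intro e he
    have := hσ _ (List.mem_map_of_mem (f := fun e => (e.1.subst ρ, e.2.subst ρ)) he)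
    simpa only [IsUnifier, subst_subst] using this
  · intro τ hτ hτl y
    rw [subst_subst, ← single_subst hτ y]
    exact subst_congr fun z _ => hmg τ (hunif τ hτ hτl) z

-- Lexicographic induction on the number of variables and the size: elimination removes a variable,
-- while decomposing two function terms or dropping a pair of equal variables reduces the size
-- without adding variables. The conclusion is sharper than in `IsMGU`, as `τ` factors through `σ`
-- by `τ` itself.
open Classical in
theorem exists_mgu_list (n m : ℕ) (l : List (L.Term V × L.Term V)) (hn : (listVars l).card ≤ n)
    (hm : listSize l ≤ m) (h : ∃ τ, Unifies τ l) :
    ∃ σ : V → L.Term V, Unifies σ l ∧ ∀ τ, Unifies τ l → ∀ x, τ x = (σ x).subst τ := by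
  induction n using Nat.strong_induction_on generalizing m l with
  | _ n ihn =>
  induction m using Nat.strong_induction_on generalizing l with
  | _ m ihm =>
  obtain ⟨τ₀, hτ₀⟩ := h
  match l with
  | [] => exact ⟨Term.var, by simp [Unifies], fun τ _ x => rfl⟩
  | (a, b) :: l =>
    have h₀ : a.subst τ₀ = b.subst τ₀ := hτ₀ _ List.mem_cons_self
    have hl : Unifies τ₀ l := fun e he => hτ₀ e (List.mem_cons_of_mem _ he)
    have elim : ∀ (x : V) (t : L.Term V), x ∉ vars t → τ₀ x = t.subst τ₀ →
        listVars ((Term.var x, t) :: l) ⊆ listVars ((a, b) :: l) →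
        ∃ σ : V → L.Term V, (σ x = t.subst σ ∧ Unifies σ l) ∧
          ∀ τ : V → L.Term V, τ x = t.subst τ → Unifies τ l → ∀ x, τ x = (σ x).subst τ := by
      intro x t hx h₀ hsub
      refine exists_mgu_of_eliminate hx h₀ hl fun l' hl' hex => ?_
      refine ihn (listVars l').card (lt_of_lt_of_le ?_ hn) _ l' le_rfl le_rfl hex
      refine lt_of_le_of_lt (Finset.card_le_card hl')
        (lt_of_lt_of_le (Finset.card_erase_lt_of_mem ?_) (Finset.card_le_card hsub))
      simp [mem_listVars]
    match a, b with
    | .var x, b =>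
      by_cases hx : x ∈ vars b
      · cases b with
        | var y =>
          obtain rfl : x = y := by simpa using hx
          obtain ⟨σ, hσ, hmg⟩ := ihm (listSize l) (by
            simp only [listSize, List.map_cons, List.sum_cons, size] at hm ⊢
            omega) l ((Finset.card_le_card (by
              intro y hy
              rw [mem_listVars] at hy ⊢
              obtain ⟨e, he, hy⟩ := hy
              exact ⟨e, List.mem_cons_of_mem _ he, hy⟩)).trans hn) le_rfl ⟨τ₀, hl⟩
          refine ⟨σ, ?_, fun τ hτ => hmg τ fun e he => hτ e (List.mem_cons_of_mem _ he)⟩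
          intro e he
          rcases List.mem_cons.1 he with rfl | he
          · rfl
          · exact hσ e he
        | func f ts => exact absurd h₀ (subst_ne_of_mem_vars hx τ₀)
      · obtain ⟨σ, ⟨h₁, h₂⟩, hmg⟩ := elim x b hx h₀ subset_rfl
        refine ⟨σ, ?_, fun τ hτ => hmg τ (hτ _ List.mem_cons_self) fun e he =>
          hτ e (List.mem_cons_of_mem _ he)⟩
        intro e he
        rcases List.mem_cons.1 he with rfl | he
        · exact h₁
        · exact h₂ e he
    | .func f ts, .var x =>
      by_cases hx : x ∈ vars (Term.func f ts)
      · exact absurd h₀.symm (subst_ne_of_mem_vars hx τ₀)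
      · obtain ⟨σ, ⟨h₁, h₂⟩, hmg⟩ := elim x _ hx h₀.symm (by
          intro y hy
          rw [mem_listVars] at hy ⊢
          obtain ⟨e, he, hy⟩ := hy
          rcases List.mem_cons.1 he with rfl | he
          · exact ⟨_, List.mem_cons_self, hy.symm⟩
          · exact ⟨e, List.mem_cons_of_mem _ he, hy⟩)
        refine ⟨σ, ?_, fun τ hτ => hmg τ (hτ _ List.mem_cons_self).symm fun e he =>
          hτ e (List.mem_cons_of_mem _ he)⟩
        intro e he
        rcases List.mem_cons.1 he with rfl | he
        · exact h₁.symm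
        · exact h₂ e he
    | @Term.func _ _ k f ts, @Term.func _ _ k' g us =>
      obtain ⟨rfl, hfg, -⟩ : ∃ h : k = k', HEq f g ∧ True := by
        simp only [Term.subst, Term.func.injEq] at h₀
        exact ⟨h₀.1, h₀.2.1, trivial⟩
      obtain rfl := eq_of_heq hfg
      set l' := List.ofFn (fun i => (ts i, us i)) ++ l
      have hiff : ∀ τ, Unifies τ l' ↔ Unifies τ ((Term.func f ts, Term.func f us) :: l) := by
        intro τ
        simp [Unifies, l', IsUnifier, or_imp, forall_and, funext_iff]
      have hvars : listVars l' ⊆ listVars ((Term.func f ts, Term.func f us) :: l) := by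
        intro y hy
        rw [mem_listVars] at hy ⊢
        obtain ⟨e, he, hy⟩ := hy
        rcases List.mem_append.1 he with he | he
        · obtain ⟨i, rfl⟩ := List.mem_ofFn.1 he
          refine ⟨_, List.mem_cons_self, ?_⟩
          exact hy.imp (fun h => mem_vars_func.2 ⟨i, h⟩) fun h => mem_vars_func.2 ⟨i, h⟩
        · exact ⟨e, List.mem_cons_of_mem _ he, hy⟩
      have hsize : listSize l' < listSize ((Term.func f ts, Term.func f us) :: l) := by
        simp only [listSize, l', List.map_append, List.sum_append, List.map_cons, List.sum_cons,
          size, List.map_ofFn, List.sum_ofFn, Function.comp_def, Finset.sum_add_distrib]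
        omega
      obtain ⟨σ, hσ, hmg⟩ := ihm (listSize l') (lt_of_lt_of_le hsize hm) l'
        ((Finset.card_le_card hvars).trans hn) le_rfl ⟨τ₀, (hiff τ₀).2 hτ₀⟩
      exact ⟨σ, (hiff σ).1 hσ, fun τ hτ => hmg τ ((hiff τ).2 hτ)⟩

/-- Unifiable terms have a most general unifier. -/
theorem exists_isMGU {s t : L.Term V} {τ : V → L.Term V} (h : IsUnifier τ s t) :
    ∃ σ, IsMGU σ s t := by
  have hiff : ∀ σ : V → L.Term V, Unifies σ [(s, t)] ↔ IsUnifier σ s t := by simp [Unifies]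
  obtain ⟨σ, hσ, hmg⟩ := exists_mgu_list _ _ [(s, t)] le_rfl le_rfl ⟨τ, (hiff τ).2 h⟩
  exact ⟨σ, (hiff σ).1 hσ, fun τ hτ => ⟨τ, hmg τ ((hiff τ).2 hτ)⟩⟩

/-! ### Critical peaks and overlaps -/

/-- This serves to rename rules apart; `IsVariant` demands a permutation of all variables. Composing
with the transposition of `π a` and a fresh `y` moves the image of `a` out of `D` and leaves the
images of the other elements alone. -/
theorem exists_perm_forall_notMem [Infinite V] (A D : Finset V) :
    ∃ π : Equiv.Perm V, ∀ x ∈ A, π x ∉ D := by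
  classical
  induction A using Finset.induction_on with
  | empty => exact ⟨1, by simp⟩
  | insert a A ha ih =>
    obtain ⟨π, hπ⟩ := ih
    obtain ⟨y, hy⟩ := Infinite.exists_notMem_finset (D ∪ A.image π)
    rw [Finset.mem_union, not_or] at hy
    refine ⟨π.trans (Equiv.swap (π a) y), ?_⟩
    intro x hx
    rcases Finset.mem_insert.1 hx with rfl | hx
    · simpa using hy.1
    · rw [Equiv.trans_apply, Equiv.swap_apply_of_ne_of_ne]
      · exact hπ x hx
      · intro h
        exact ha (π.injective h ▸ hx)
      · rintro rfl
        exact hy.2 (Finset.mem_image_of_mem _ hx)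

theorem isVariant_refl (l r : L.Term V) : IsVariant l r l r :=
  ⟨1, by simp [relabel_eq_subst], by simp [relabel_eq_subst]⟩

/-- An overlap at a function symbol position is trivial, or it is an instance of a critical
peak. -/
theorem exists_isCriticalPeak [Infinite V] {S₁ S₂ : PairSet L V}
    (hS₁ : ∀ l r, (l, r) ∈ S₁ → vars r ⊆ vars l) {l₁ r₁ l₂ r₂ v : L.Term V}
    (h₁ : (l₁, r₁) ∈ S₁) (h₂ : (l₂, r₂) ∈ S₂) {p : List ℕ} (hp : IsFunPos l₂ p)
    (hv : subtermAt l₂ p = some v) {τ₁ τ₂ : V → L.Term V} (h : l₁.subst τ₁ = v.subst τ₂) :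
    (p = [] ∧ r₁.subst τ₁ = r₂.subst τ₂) ∨
      ∃ (t s u : L.Term V) (δ : V → L.Term V), IsCriticalPeak S₁ S₂ t p s u ∧
        s.subst δ = l₂.subst τ₂ ∧ t.subst δ = replaceAt (l₂.subst τ₂) p (r₁.subst τ₁) ∧
        u.subst δ = r₂.subst τ₂ := by
  classical
  obtain ⟨π, hπ⟩ := exists_perm_forall_notMem (vars l₁ ∪ vars r₁) (vars l₂ ∪ vars r₂)
  -- Once the first rule is renamed apart by `π`, one substitution yields both instances.
  set τ : V → L.Term V := fun x => if x ∈ vars l₂ ∪ vars r₂ then τ₂ x else τ₁ (π.symm x)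
  have hτ₂ : ∀ t : L.Term V, vars t ⊆ vars l₂ ∪ vars r₂ → t.subst τ = t.subst τ₂ := by
    intro t ht
    exact subst_congr fun x hx => if_pos (ht hx)
  have hτ₁ : ∀ t : L.Term V, vars t ⊆ vars l₁ ∪ vars r₁ →
      (t.relabel π).subst τ = t.subst τ₁ := by
    intro t ht
    rw [relabel_eq_subst, subst_subst]
    refine subst_congr fun x hx => ?_
    simp only [Term.subst, τ]
    rw [if_neg (hπ x (ht hx)), Equiv.symm_apply_apply]
  have hl₂ := hτ₂ l₂ Finset.subset_union_left
  have hr₂ := hτ₂ r₂ Finset.subset_union_right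
  have hv₂ := hτ₂ v ((vars_subset_of_subtermAt hv).trans Finset.subset_union_left)
  have hl₁ := hτ₁ l₁ Finset.subset_union_left
  have hr₁ := hτ₁ r₁ Finset.subset_union_right
  have hunif : IsUnifier τ (l₁.relabel π) v := by
    rw [IsUnifier, hl₁, hv₂, h]
  -- This is the case that overlaps exclude. Equal instances of the left-hand sides force agreement
  -- on their variables, which include those of the right-hand sides, so both steps have the same
  -- result.
  by_cases hvar : p = [] ∧ IsVariant (l₁.relabel π) (r₁.relabel π) l₂ r₂
  · obtain ⟨rfl, ρ, hl, hr⟩ := hvar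
    refine .inl ⟨rfl, ?_⟩
    obtain rfl : l₂ = v := by simpa using hv
    rw [← hr₁, ← hr₂, ← hr]
    rw [relabel_eq_subst ρ, subst_subst]
    have heq : ∀ (t : L.Term V), t.subst τ = (t.relabel ρ).subst τ →
        ∀ x ∈ vars t, τ x = τ (ρ x) := by
      intro t ht x hx
      rw [relabel_eq_subst, subst_subst] at ht
      induction t with
      | var y =>
        obtain rfl : x = y := by simpa using hx
        exact ht
      | func f ts ih =>
        obtain ⟨i, hi⟩ := mem_vars_func.1 hx
        simp only [Term.subst, Term.func.injEq, heq_eq_eq, true_and, funext_iff] at ht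
        exact ih i (ht i) hi
    refine subst_congr fun x hx => heq _ (by rw [hl]; exact hunif) x ?_
    obtain ⟨y, hy, rfl⟩ := mem_vars_relabel.1 hx
    exact mem_vars_relabel.2 ⟨y, hS₁ _ _ h₁ hy, rfl⟩
  · obtain ⟨σ, hσ⟩ := exists_isMGU hunif
    obtain ⟨δ, hδ⟩ := hσ.2 τ hunif
    have hσδ : ∀ t : L.Term V, (t.subst σ).subst δ = t.subst τ := by
      intro t
      rw [subst_subst]
      exact subst_congr fun x _ => (hδ x).symm
    refine .inr ⟨_, _, _, δ, ⟨_, _, l₂, r₂, v, σ, ⟨⟨l₁, r₁, h₁, π, rfl, rfl⟩,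
      ⟨l₂, r₂, h₂, isVariant_refl _ _⟩, ?_, hp, ⟨v, τ, hv, hunif⟩, fun hp' hv' => hvar ⟨hp', hv'⟩⟩,
      hv, hσ, rfl, rfl, rfl⟩, ?_, ?_, ?_⟩
    · rw [Set.disjoint_left]
      intro x hx hx'
      have : ∃ y ∈ vars l₁ ∪ vars r₁, x = π y := by
        rcases hx with hx | hx
        · obtain ⟨y, hy, rfl⟩ := mem_vars_relabel.1 hx
          exact ⟨y, Finset.mem_union_left _ hy, rfl⟩
        · obtain ⟨y, hy, rfl⟩ := mem_vars_relabel.1 hx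
          exact ⟨y, Finset.mem_union_right _ hy, rfl⟩
      obtain ⟨y, hy, rfl⟩ := this
      exact hπ y hy (by simpa using hx')
    · rw [hσδ, hl₂]
    · rw [replaceAt_subst ⟨_, subtermAt_subst hv σ⟩, hσδ, hσδ, hl₂, hr₁]
    · rw [hσδ, hr₂]

/-! ### Prime steps -/

/-- A reducible subterm stays reducible under `σ`. Thus primality of a concrete step passes to the
critical peak of which it is an instance. -/
theorem IsPrimeAt.of_subst {R : PairSet L V} {p : List ℕ} {s : L.Term V} {σ : V → L.Term V}
    (h : IsPrimeAt R p (s.subst σ)) : IsPrimeAt R p s := by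
  rintro q v hq hv ⟨u, hu⟩
  exact h q _ hq (subtermAt_subst hv σ) ⟨_, substClosed_rew R hu σ⟩

theorem IsPrimeAt.of_append {R : PairSet L V} {p q : List ℕ} {s s₀ : L.Term V}
    (h : IsPrimeAt R (p ++ q) s) (hs : subtermAt s p = some s₀) : IsPrimeAt R q s₀ := by
  intro q' v hq' hv
  refine h q' v hq' ?_
  rwa [List.append_assoc, subtermAt_append hs]

theorem isPrimeAt_append_iff {R : PairSet L V} {p q : List ℕ} {s s₀ : L.Term V}
    (hs : subtermAt s p = some s₀) : IsPrimeAt R (p ++ q) s ↔ IsPrimeAt R q s₀ := by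
  simp only [IsPrimeAt, List.append_assoc, subtermAt_append hs]

theorem size_arg_lt {k : ℕ} (f : L.Functions k) (ts : Fin k → L.Term V) (i : Fin k) :
    size (ts i) < size (Term.func f ts) := by
  have h := Finset.single_le_sum (f := fun j => size (ts j)) (fun _ _ => Nat.zero_le _)
    (Finset.mem_univ i)
  simp only [size]
  omega

theorem size_le_of_subtermAt {t u : L.Term V} {p : List ℕ} (h : subtermAt t p = some u) :
    size u ≤ size t := by
  induction t generalizing p with
  | var x => cases p <;> simp_all
  | func f ts ih =>
    cases p with
    | nil => simp_all
    | cons i p =>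
      obtain ⟨j, rfl, hj⟩ := subtermAt_func_cons_eq_some.1 h
      exact (ih j hj).trans (size_arg_lt f ts j).le

/-- A reducible term has a step whose redex has irreducible proper subterms. -/
theorem exists_rewAt_isPrimeAt {R : PairSet L V} {s : L.Term V} (h : ¬ IsNF R s) :
    ∃ p t, RewAt R p s t ∧ IsPrimeAt R p s := by
  induction hn : size s using Nat.strong_induction_on generalizing s with
  | _ n ih =>
  by_cases hprime : IsPrimeAt R [] s
  · obtain ⟨t, ht⟩ := not_not.1 h
    obtain ⟨p, ht⟩ := rew_iff_exists_rewAt.1 ht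
    obtain ⟨u, hu⟩ := ht.isPos
    have hp : p = [] := by
      by_contra hp
      refine hprime p u hp (by simpa using hu) ?_
      obtain ⟨t₀, ht₀, -⟩ := RewAt.exists_subterm (q := p) (p := []) (by simpa using ht) hu
      exact ⟨t₀, ht₀.rew⟩
    subst hp
    exact ⟨[], t, ht, hprime⟩
  · simp only [IsPrimeAt, not_forall, List.nil_append] at hprime
    obtain ⟨q, v, hq, hv, hnf⟩ := hprime
    have hlt : size v < n := by
      subst hn
      cases s with
      | var x => cases q <;> simp_all
      | func f ts =>
        cases q with
        | nil => exact absurd rfl hq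
        | cons i q =>
          obtain ⟨j, rfl, hj⟩ := subtermAt_func_cons_eq_some.1 hv
          exact lt_of_le_of_lt (size_le_of_subtermAt hj) (size_arg_lt f ts j)
    obtain ⟨p, t, ht, hp⟩ := ih _ hlt hnf rfl
    refine ⟨q ++ p, replaceAt s q t, ?_, (isPrimeAt_append_iff hv).2 hp⟩
    have := ht.context (c := s) (q := q) ⟨_, hv⟩
    rwa [replaceAt_self hv] at this

/-- The new position extends `p`, so this prime step lies below every step at `p` or above it and
can be compared with each of them as the inner step. -/
theorem exists_rewAt_of_not_isPrimeAt {R : PairSet L V} {p : List ℕ} {s : L.Term V}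
    (h : ¬ IsPrimeAt R p s) : ∃ q t, RewAt R (p ++ q) s t ∧ IsPrimeAt R (p ++ q) s := by
  simp only [IsPrimeAt, not_forall] at h
  obtain ⟨q, v, -, hv, hnf⟩ := h
  obtain ⟨q', t, ht, hp⟩ := exists_rewAt_isPrimeAt hnf
  refine ⟨q ++ q', replaceAt s (p ++ q) t, ?_, ?_⟩
  · have := ht.context (c := s) (q := p ++ q) ⟨_, hv⟩
    rwa [replaceAt_self hv, List.append_assoc] at this
  · rw [← List.append_assoc]
    exact (isPrimeAt_append_iff hv).2 hp

/-! ### Local peaks and cliffs -/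

/-- A step at or below the position of another step: the overlap is trivial, an instance of a
critical peak, or a variable overlap. -/
theorem rel_of_overlap [Infinite V] {R S₁ S₂ : PairSet L V}
    (hS₁ : ∀ l r, (l, r) ∈ S₁ → vars r ⊆ vars l) {K : L.Term V → L.Term V → Prop}
    (hKc : ContextClosed K) (hKσ : SubstClosed K) (hKr : ∀ t, K t t)
    (hcrit : ∀ t p s u, IsCriticalPeak S₁ S₂ t p s u → IsPrimeAt R p s → K t u)
    (hvar : ∀ l r τ x p a q, (l, r) ∈ S₂ → subtermAt l p = some (.var x) →
      RewAt S₁ q (τ x) a → K (replaceAt (l.subst τ) p a) (r.subst τ))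
    {s t u : L.Term V} {p q : List ℕ} (ht : RewAt S₁ (p ++ q) s t) (hu : RewAt S₂ p s u)
    (hprime : IsPrimeAt R (p ++ q) s) : K t u := by
  obtain ⟨s₀, hs₀⟩ := hu.isPos
  obtain ⟨t₀, ht₀, rfl⟩ := ht.exists_subterm hs₀
  obtain ⟨u₀, hu₀, rfl⟩ := RewAt.exists_subterm (p := []) (by simpa using hu) hs₀
  refine hKc ?_ ⟨_, hs₀⟩
  replace hprime := hprime.of_append hs₀
  clear hs₀ ht hu
  obtain ⟨l₂, r₂, τ₂, hlr₂, hl₂, rfl⟩ := hu₀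
  obtain rfl : s₀ = l₂.subst τ₂ := by simpa using hl₂
  rw [replaceAt_nil]
  obtain ⟨l₁, r₁, τ₁, hlr₁, hl₁, rfl⟩ := id ht₀
  rcases subtermAt_subst_cases hl₁ with ⟨v, hfun, hv, heq⟩ | ⟨q₁, q₂, x, rfl, hq₁, hq₂⟩
  · rcases exists_isCriticalPeak hS₁ hlr₁ hlr₂ hfun hv heq with
      ⟨rfl, h⟩ | ⟨t', s', u', δ, hpeak, hs', ht', hu'⟩
    · rw [replaceAt_nil, h]
      exact hKr _
    · rw [← ht', ← hu']
      refine hKσ (hcrit _ _ _ _ hpeak ?_) δ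
      rw [← hs'] at hprime
      exact hprime.of_subst
  · have hx : subtermAt (l₂.subst τ₂) q₁ = some (τ₂ x) := by
      simpa using subtermAt_subst hq₁ τ₂
    obtain ⟨a, ha, heq⟩ := ht₀.exists_subterm hx
    rw [heq]
    exact hvar l₂ r₂ τ₂ x q₁ a q₂ hlr₂ hq₁ ha

theorem reflTransGen_update [DecidableEq V] {rel : L.Term V → L.Term V → Prop}
    {τ : V → L.Term V} {x : V} {a : L.Term V} (h : Relation.ReflTransGen rel (τ x) a) (y : V) :
    Relation.ReflTransGen rel (τ y) (Function.update τ x a y) := by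
  by_cases hy : y = x
  · subst hy; simpa using h
  · simpa [hy] using Relation.ReflTransGen.refl

/-- A variable overlap with an inner step of `R`. -/
theorem exists_reflTransGen_of_variable_overlap {R : PairSet L V} {l r : L.Term V}
    {τ : V → L.Term V} {x : V} {p : List ℕ} {a : L.Term V}
    (hp : subtermAt l p = some (.var x)) (ha : Rew R (τ x) a) :
    ∃ τ' : V → L.Term V,
      Relation.ReflTransGen (Rew R) (replaceAt (l.subst τ) p a) (l.subst τ') ∧
      Relation.ReflTransGen (Rew R) (r.subst τ) (r.subst τ') := by
  classical
  have h := reflTransGen_update (x := x) (.single ha)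
  have hc := contextClosed_rew R
  refine ⟨Function.update τ x a, ?_, reflTransGen_subst hc h r⟩
  simpa using reflTransGen_replaceAt_subst hc h hp

theorem Rew.subst_of_mem {E : PairSet L V} {l r : L.Term V} (h : (l, r) ∈ E)
    (σ : V → L.Term V) : Rew E (l.subst σ) (r.subst σ) :=
  substClosed_rew E (rew_of_mem h) σ

theorem symmPairs_vars {B : PairSet L V} (hB : ∀ l r, (l, r) ∈ B → vars l = vars r) :
    ∀ l r, (l, r) ∈ symmPairs B → vars r ⊆ vars l := by
  rintro l r (h | h)
  · exact (hB l r h).ge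
  · exact (hB r l h).le

theorem symRew_subst_of_mem_symmPairs {B : PairSet L V} {l r : L.Term V} (h : (l, r) ∈ symmPairs B)
    (σ : V → L.Term V) : SymRew B (l.subst σ) (r.subst σ) :=
  h.imp (fun h => Rew.subst_of_mem h σ) fun h => Rew.subst_of_mem h σ

section LocalConfluence

variable [Infinite V] {R B : PairSet L V} {K : L.Term V → L.Term V → Prop}

/-- In a variable overlap the inner step is repeated at all copies of the variable; the outer rule
then applies and both sides meet. In the application, `K` consists of valleys and single steps of
the run. -/
theorem rel_of_peak (hR : ∀ l r, (l, r) ∈ R → vars r ⊆ vars l) (hKc : ContextClosed K)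
    (hKσ : SubstClosed K) (hV : ∀ t u, Valley R B t u → K t u)
    (hPCP : ∀ t u, (t, u) ∈ PCP R → K t u)
    {s t u : L.Term V} {p q : List ℕ} (ht : RewAt R (p ++ q) s t) (hu : RewAt R p s u)
    (hprime : IsPrimeAt R (p ++ q) s) : K t u := by
  refine rel_of_overlap hR hKc hKσ (fun t => hV t t ⟨t, t, .refl, Conv.refl _ _, .refl⟩)
    (fun t p s u hpeak hp => hPCP t u ⟨p, s, hpeak, hp⟩) ?_ ht hu hprime
  intro l r τ x p a q hlr hp ha
  obtain ⟨τ', h₁, h₂⟩ := exists_reflTransGen_of_variable_overlap (r := r) hp ha.rew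
  exact hV _ _ ⟨_, _, h₁.tail (Rew.subst_of_mem hlr τ'), Conv.refl _ _, h₂⟩

/-- No linearity of `B` is needed: the `R`-step is repeated at all copies of the variable on both
sides, and a `B`-step connects the results. -/
theorem rel_of_cliff_below (hR : ∀ l r, (l, r) ∈ R → vars r ⊆ vars l) (hKc : ContextClosed K)
    (hKσ : SubstClosed K) (hV : ∀ t u, Valley R B t u → K t u)
    (hPCP : ∀ t u, (t, u) ∈ PCPpm R (symmPairs B) → K t u)
    {s t u : L.Term V} {p q : List ℕ} (ht : RewAt R (p ++ q) s t)
    (hu : RewAt (symmPairs B) p s u) (hprime : IsPrimeAt R (p ++ q) s) : K t u := by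
  refine rel_of_overlap hR hKc hKσ (fun t => hV t t ⟨t, t, .refl, Conv.refl _ _, .refl⟩)
    (fun t p s u hpeak hp => hPCP t u ⟨p, s, .inl hpeak, hp⟩) ?_ ht hu hprime
  intro l r τ x p a q hlr hp ha
  obtain ⟨τ', h₁, h₂⟩ := exists_reflTransGen_of_variable_overlap (r := r) hp ha.rew
  exact hV _ _ ⟨_, _, h₁, (symRew_subst_of_mem_symmPairs hlr τ').conv, h₂⟩

/-- Here left-linearity is essential. A `B`-step at one of several copies of a variable could
destroy the redex, and a valley allows no `B`-steps before its rewrite steps to repair it. -/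
theorem rel_of_cliff_above (hlin : IsLeftLinear R)
    (hB : ∀ l r, (l, r) ∈ B → vars l = vars r) (hKc : ContextClosed K)
    (hKσ : SubstClosed K) (hV : ∀ t u, Valley R B t u → K t u)
    (hPCP : ∀ t u, (t, u) ∈ PCPpm R (symmPairs B) → K t u)
    {s t u : L.Term V} {p q : List ℕ} (ht : RewAt R p s t)
    (hu : RewAt (symmPairs B) (p ++ q) s u) (hprime : IsPrimeAt R (p ++ q) s) : K u t := by
  classical
  refine rel_of_overlap (symmPairs_vars hB) hKc hKσ
    (fun t => hV t t ⟨t, t, .refl, Conv.refl _ _, .refl⟩)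
    (fun t p s u hpeak hp => hPCP t u ⟨p, s, .inr hpeak, hp⟩) ?_ hu ht hprime
  intro l r τ x p a q hlr hp ha
  have heq := replaceAt_subst_of_unique (τ := τ) (τ' := Function.update τ x a)
    (fun y hy => by simp [hy]) hp fun q hq => hlin l r hlr x q p hq hp
  rw [Function.update_self] at heq
  rw [heq]
  exact hV _ _ ⟨_, _, .single (Rew.subst_of_mem hlr _), Conv.symm (reflTransGen_subst
    (contextClosed_symRew B) (reflTransGen_update (.single ha.symRew)) r), .refl⟩

/-- Local peaks are covered by the prime critical pairs. -/
theorem peak_cases (hR : ∀ l r, (l, r) ∈ R → vars r ⊆ vars l) (hKc : ContextClosed K)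
    (hKσ : SubstClosed K) (hKs : ∀ t u, K t u → K u t) (hV : ∀ t u, Valley R B t u → K t u)
    (hPCP : ∀ t u, (t, u) ∈ PCP R → K t u) {s t u : L.Term V} (ht : Rew R s t)
    (hu : Rew R s u) : K t u ∨ ∃ v, Rew R s v ∧ K t v ∧ K v u := by
  obtain ⟨p, ht⟩ := rew_iff_exists_rewAt.1 ht
  obtain ⟨p', hu⟩ := rew_iff_exists_rewAt.1 hu
  have key : ∀ {t u p q}, RewAt R (p ++ q) s t → RewAt R p s u →
      K t u ∨ ∃ v, Rew R s v ∧ K v t ∧ K v u := by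
    intro t u p q ht hu
    by_cases hprime : IsPrimeAt R (p ++ q) s
    · exact .inl (rel_of_peak hR hKc hKσ hV hPCP ht hu hprime)
    -- The prime step to `v` lies below both given steps, so the peak splits into two peaks with a
    -- prime inner step.
    · obtain ⟨q', v, hv, hprime⟩ := exists_rewAt_of_not_isPrimeAt hprime
      refine .inr ⟨v, hv.rew, rel_of_peak hR hKc hKσ hV hPCP hv ht hprime, ?_⟩
      rw [List.append_assoc] at hv hprime
      exact rel_of_peak hR hKc hKσ hV hPCP hv hu hprime
  by_cases h₁ : p <+: p'
  · obtain ⟨q, rfl⟩ := h₁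
    rcases key hu ht with h | ⟨v, hv, h₁, h₂⟩
    · exact .inl (hKs _ _ h)
    · exact .inr ⟨v, hv, hKs _ _ h₂, h₁⟩
  · by_cases h₂ : p' <+: p
    · obtain ⟨q, rfl⟩ := h₂
      rcases key ht hu with h | ⟨v, hv, h₁, h₂⟩
      · exact .inl h
      · exact .inr ⟨v, hv, hKs _ _ h₁, h₂⟩
    · obtain ⟨v, hv, hv'⟩ := ht.commute h₁ h₂ hu
      exact .inl (hV _ _ ⟨v, v, .single hv.rew, Conv.refl _ _, .single hv'.rew⟩)

/-- Local cliffs are covered by the prime critical pairs. -/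
theorem cliff_cases {K' : L.Term V → L.Term V → Prop}
    (hR : ∀ l r, (l, r) ∈ R → vars r ⊆ vars l) (hlin : IsLeftLinear R)
    (hB : ∀ l r, (l, r) ∈ B → vars l = vars r) (hKc : ContextClosed K)
    (hKσ : SubstClosed K) (hV : ∀ t u, Valley R B t u → K t u)
    (hPCP : ∀ t u, (t, u) ∈ PCP R → K t u) (hKc' : ContextClosed K')
    (hKσ' : SubstClosed K') (hKs' : ∀ t u, K' t u → K' u t)
    (hV' : ∀ t u, Valley R B t u → K' t u)
    (hPCP' : ∀ t u, (t, u) ∈ PCPpm R (symmPairs B) → K' t u)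
    {s t u : L.Term V} (ht : Rew R s t) (hu : SymRew B s u) :
    K' t u ∨ ∃ v, Rew R s v ∧ K v t ∧ K' v u := by
  obtain ⟨p, ht⟩ := rew_iff_exists_rewAt.1 ht
  obtain ⟨p', hu⟩ := symRew_iff_exists_rewAt.1 hu
  by_cases h₁ : p <+: p'
  · obtain ⟨q, rfl⟩ := h₁
    by_cases hprime : IsPrimeAt R (p ++ q) s
    · exact .inl (hKs' _ _ (rel_of_cliff_above hlin hB hKc' hKσ' hV' hPCP' ht hu hprime))
    -- The prime `R`-step to `v` splits the cliff into a peak, for which `K` suffices, and a cliff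
    -- whose `R`-step is the lower one.
    · obtain ⟨q', v, hv, hprime⟩ := exists_rewAt_of_not_isPrimeAt hprime
      refine .inr ⟨v, hv.rew, ?_, rel_of_cliff_below hR hKc' hKσ' hV' hPCP' hv hu hprime⟩
      rw [List.append_assoc] at hv hprime
      exact rel_of_peak hR hKc hKσ hV hPCP hv ht hprime
  · by_cases h₂ : p' <+: p
    · obtain ⟨q, rfl⟩ := h₂
      by_cases hprime : IsPrimeAt R (p' ++ q) s
      · exact .inl (rel_of_cliff_below hR hKc' hKσ' hV' hPCP' ht hu hprime)
      · obtain ⟨q', v, hv, hprime⟩ := exists_rewAt_of_not_isPrimeAt hprime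
        refine .inr ⟨v, hv.rew, rel_of_peak hR hKc hKσ hV hPCP hv ht hprime, ?_⟩
        rw [List.append_assoc] at hv hprime
        exact rel_of_cliff_below hR hKc' hKσ' hV' hPCP' hv hu hprime
    · obtain ⟨v, hv, hv'⟩ := ht.commute h₁ h₂ hu
      exact .inl (hV' _ _ ⟨t, v, .refl, hv.symRew.conv, .single hv'.rew⟩)

end LocalConfluence

/-! ### Church-Rosser modulo by source-decreasing conversions -/

/-- Conversions with `R` and `B` through terms that satisfy `P`. -/
def BoundedConv (R B : PairSet L V) (P : L.Term V → Prop) : L.Term V → L.Term V → Prop :=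
  Relation.ReflTransGen fun a b => P a ∧ P b ∧ (SymRew R a b ∨ SymRew B a b)

section BoundedConv

variable {R B : PairSet L V} {P : L.Term V → Prop} {gt : L.Term V → L.Term V → Prop}

theorem BoundedConv.symm {s t : L.Term V} (h : BoundedConv R B P s t) :
    BoundedConv R B P t s :=
  haveI : Std.Symm fun a b => P a ∧ P b ∧ (SymRew R a b ∨ SymRew B a b) :=
    ⟨fun _ _ ⟨ha, hb, h⟩ => ⟨hb, ha, h.imp SymRew.symm SymRew.symm⟩⟩
  Relation.ReflTransGen.stdSymm.symm _ _ h

theorem BoundedConv.trans {s t u : L.Term V} (h : BoundedConv R B P s t)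
    (h' : BoundedConv R B P t u) : BoundedConv R B P s u :=
  Relation.ReflTransGen.trans h h'

theorem BoundedConv.conv {s t : L.Term V} (h : BoundedConv R B P s t) : Conv (R ∪ B) s t := by
  refine Relation.ReflTransGen.mono ?_ _ _ h
  rintro a b ⟨-, -, h | h⟩
  · exact h.mono Set.subset_union_left
  · exact h.mono Set.subset_union_right

theorem BoundedConv.of_rew {s t : L.Term V} (hs : P s) (ht : P t) (h : Rew R s t) :
    BoundedConv R B P s t :=
  .single ⟨hs, ht, .inl (.inl h)⟩

/-- The property `P` is inherited by smaller and by equivalent terms. -/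
def DownClosed (B : PairSet L V) (gt : L.Term V → L.Term V → Prop) (P : L.Term V → Prop) : Prop :=
  (∀ a b, P a → gt a b → P b) ∧ ∀ a b, P a → Conv B a b → P b

theorem BoundedConv.of_conv (hP : DownClosed B gt P) {s t : L.Term V} (hs : P s)
    (h : Conv B s t) : BoundedConv R B P s t := by
  induction h with
  | refl => exact .refl
  | tail h₁ h₂ ih =>
    have := hP.2 _ _ hs h₁
    exact ih.tail ⟨this, hP.2 _ _ this h₂.conv, .inr h₂⟩

theorem BoundedConv.of_reflTransGen (hP : DownClosed B gt P) (hR : ∀ a b, Rew R a b → gt a b)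
    {s t : L.Term V} (hs : P s) (h : Relation.ReflTransGen (Rew R) s t) :
    P t ∧ BoundedConv R B P s t := by
  induction h with
  | refl => exact ⟨hs, .refl⟩
  | tail _ h ih =>
    have := hP.1 _ _ ih.1 (hR _ _ h)
    exact ⟨this, ih.2.tail ⟨ih.1, this, .inl (.inl h)⟩⟩

theorem BoundedConv.of_valley (hP : DownClosed B gt P) (hR : ∀ a b, Rew R a b → gt a b)
    {s t : L.Term V} (hs : P s) (ht : P t) (h : Valley R B s t) : BoundedConv R B P s t := by
  obtain ⟨s', t', hs', h, ht'⟩ := h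
  obtain ⟨hPs, hs'⟩ := of_reflTransGen hP hR hs hs'
  exact hs'.trans ((of_conv hP hPs h).trans (of_reflTransGen hP hR ht ht').2.symm)

theorem IsCompatibleReductionOrder.contextClosed
    (hgt : IsCompatibleReductionOrder B gt) :
    ContextClosed gt := fun s t h c p hc =>
  hgt.closed_context s t c p hc h

theorem IsCompatibleReductionOrder.substClosed
    (hgt : IsCompatibleReductionOrder B gt) :
    SubstClosed gt := fun s t h σ =>
  hgt.closed_subst s t σ h

theorem IsCompatibleReductionOrder.gt_of_rew
    (hgt : IsCompatibleReductionOrder B gt)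
    (hR : ∀ l r, (l, r) ∈ R → gt l r) (a b : L.Term V)
    (h : Rew R a b) : gt a b :=
  h.of_closed hgt.contextClosed hgt.substClosed hR

theorem IsCompatibleReductionOrder.irrefl
    (hgt : IsCompatibleReductionOrder B gt) (a : L.Term V) :
    ¬ gt a a := fun h =>
  (hgt.wf.irrefl).irrefl a h

theorem IsCompatibleReductionOrder.downClosed
    (hgt : IsCompatibleReductionOrder B gt) (a : L.Term V) :
    DownClosed B gt (gt a) :=
  ⟨fun b c hab hbc => hgt.trans a b c hab hbc, fun b c hab hbc =>
    hgt.compatible a a b c (Conv.refl _ _) hab hbc⟩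

theorem IsCompatibleReductionOrder.exists_nf
    (hgt : IsCompatibleReductionOrder B gt)
    (hR : ∀ a b, Rew R a b → gt a b) (a : L.Term V) :
    ∃ b, Relation.ReflTransGen (Rew R) a b ∧ IsNF R b := by
  induction a using hgt.wf.induction with
  | _ a ih =>
  by_cases h : IsNF R a
  · exact ⟨a, .refl, h⟩
  · obtain ⟨b, hb⟩ := not_not.1 h
    obtain ⟨c, hc, hnf⟩ := ih b (hR _ _ hb)
    exact ⟨c, hc.head hb, hnf⟩

/-- Church-Rosser modulo follows from source-decreasing local peaks and cliffs. -/
theorem churchRosserMod_of_local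
    (hgt : IsCompatibleReductionOrder B gt)
    (hR : ∀ a b, Rew R a b → gt a b)
    (hpeak : ∀ s t u, Rew R s t → Rew R s u → BoundedConv R B (gt s) t u)
    (hcliff : ∀ s t u, Rew R s t → SymRew B s u →
      ∃ v, Rew R u v ∧ BoundedConv R B (gt s) v t) : ChurchRosserMod R B := by
  -- Normal forms of equal or adjacent terms are equivalent.
  have key : ∀ a : L.Term V, (∀ b c, Relation.ReflTransGen (Rew R) a b → IsNF R b →
      Relation.ReflTransGen (Rew R) a c → IsNF R c → Conv B b c) ∧
      ∀ a' b c, SymRew B a a' → Relation.ReflTransGen (Rew R) a b → IsNF R b →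
        Relation.ReflTransGen (Rew R) a' c → IsNF R c → Conv B b c := by
    intro a
    induction a using hgt.wf.induction with
    | _ a ih =>
    -- Along a conversion below `a`, the induction hypothesis compares the normal forms of
    -- neighbouring terms.
    have hbelow : ∀ {s t}, BoundedConv R B (gt a) s t → ∀ b c, gt a s →
        Relation.ReflTransGen (Rew R) s b → IsNF R b →
        Relation.ReflTransGen (Rew R) t c → IsNF R c → Conv B b c := by
      intro s t h
      induction h using Relation.ReflTransGen.head_induction_on with
      | refl => exact fun b c hs hb hnb hc hnc => (ih _ hs).1 b c hb hnb hc hnc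
      | @head x y h _ ih' =>
        intro b c hx hb hnb hc hnc
        obtain ⟨hx, hy, h⟩ := h
        obtain ⟨d, hd, hnd⟩ := hgt.exists_nf hR y
        refine Conv.trans ?_ (ih' d c hy hd hnd hc hnc)
        rcases h with (h | h) | h
        · exact (ih _ hx).1 b d hb hnb (hd.head h) hnd
        · exact (ih _ hy).1 b d (hb.head h) hnb hd hnd
        · exact (ih _ hx).2 y b d h hb hnb hd hnd
    -- The first claim is proved for the whole `∼`-class of `a`: by compatibility all its members
    -- have the same smaller terms, so the hypothesis for `a` covers each of them.
    have hequiv : ∀ a', Conv B a a' → ∀ b c, Relation.ReflTransGen (Rew R) a' b → IsNF R b →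
        Relation.ReflTransGen (Rew R) a' c → IsNF R c → Conv B b c := by
      intro a' ha b c hb hnb hc hnc
      rcases hb.cases_head with rfl | ⟨b', hb', hb⟩
      · rcases hc.cases_head with rfl | ⟨c', hc', hc⟩
        · exact Conv.refl _ _
        · exact absurd ⟨_, hc'⟩ hnb
      · rcases hc.cases_head with rfl | ⟨c', hc', hc⟩
        · exact absurd ⟨_, hb'⟩ hnc
        · have hlt : ∀ x, gt a' x → gt a x := fun x hx =>
            hgt.compatible a a' x x ha hx (Conv.refl _ _)
          refine hbelow ?_ b c (hlt _ (hR _ _ hb')) hb hnb hc hnc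
          refine Relation.ReflTransGen.mono ?_ _ _ (hpeak a' b' c' hb' hc')
          exact fun x y ⟨hx, hy, h⟩ => ⟨hlt x hx, hlt y hy, h⟩
    refine ⟨hequiv a (Conv.refl _ _), ?_⟩
    -- The cliff at `x` supplies a successor `v` of `y`. A normal form of `v` is equivalent to `b`
    -- by `hbelow` and, being a normal form of `y`, to `c` by `hequiv`.
    have hstep : ∀ x y b c, Conv B a x → SymRew B x y → ¬ IsNF R x →
        Relation.ReflTransGen (Rew R) x b → IsNF R b →
        Relation.ReflTransGen (Rew R) y c → IsNF R c → Conv B b c := by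
      intro x y b c hax hxy hx hb hnb hc hnc
      rcases hb.cases_head with rfl | ⟨b', hb', hb⟩
      · exact absurd hnb hx
      obtain ⟨v, hv, hvb⟩ := hcliff x b' y hb' hxy
      obtain ⟨d, hd, hnd⟩ := hgt.exists_nf hR v
      have hlt : ∀ z, gt x z → gt a z := fun z hz =>
        hgt.compatible a x z z hax hz (Conv.refl _ _)
      refine Conv.trans ?_ (hequiv y (hax.trans hxy.conv) d c (hd.head hv) hnd hc hnc)
      refine hbelow (BoundedConv.symm ?_) b d (hlt _ (hR _ _ hb')) hb hnb hd hnd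
      refine Relation.ReflTransGen.mono ?_ _ _ hvb
      exact fun x y ⟨hx, hy, h⟩ => ⟨hlt x hx, hlt y hy, h⟩
    intro a' b c haa' hb hnb hc hnc
    by_cases ha : IsNF R a
    · by_cases ha' : IsNF R a'
      · rcases hb.cases_head with rfl | ⟨b', hb', -⟩
        · rcases hc.cases_head with rfl | ⟨c', hc', -⟩
          · exact haa'.conv
          · exact absurd ⟨_, hc'⟩ ha'
        · exact absurd ⟨_, hb'⟩ ha
      -- Only `a'` is reducible, so the cliff is taken at `a'`.
      · exact (hstep a' a c b haa'.conv haa'.symm ha' hc hnc hb hnb).symm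
    · exact hstep a a' b c (Conv.refl _ _) haa' ha hb hnb hc hnc
  have hconv : ∀ s t, Conv B s t → ∀ b c, Relation.ReflTransGen (Rew R) s b → IsNF R b →
      Relation.ReflTransGen (Rew R) t c → IsNF R c → Conv B b c := by
    intro s t h
    induction h with
    | refl => exact (key s).1
    | @tail x y _ h ih =>
      intro b c hb hnb hc hnc
      obtain ⟨d, hd, hnd⟩ := hgt.exists_nf hR x
      exact (ih b d hb hnb hd hnd).trans ((key x).2 y d c h hd hnd hc hnc)
  have hall : ∀ s t, Relation.ReflTransGen (fun a b => Rew R b a ∨ Rew R a b ∨ Conv B a b) s t →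
      ∀ b c, Relation.ReflTransGen (Rew R) s b → IsNF R b →
        Relation.ReflTransGen (Rew R) t c → IsNF R c → Conv B b c := by
    intro s t h
    induction h with
    | refl => exact (key s).1
    | @tail x y _ h ih =>
      intro b c hb hnb hc hnc
      obtain ⟨d, hd, hnd⟩ := hgt.exists_nf hR x
      refine (ih b d hb hnb hd hnd).trans ?_
      rcases h with h | h | h
      · exact (key y).1 d c (hd.head h) hnd hc hnc
      · exact (key x).1 d c hd hnd (hc.head h) hnc
      · exact hconv x y h d c hd hnd hc hnc
  intro s t h
  obtain ⟨b, hb, hnb⟩ := hgt.exists_nf hR s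
  obtain ⟨c, hc, hnc⟩ := hgt.exists_nf hR t
  exact ⟨b, c, hb, hall s t h b c hb hnb hc hnc, hc⟩

end BoundedConv

/-! ### Reduction orders and runs -/

section Runs

variable {B : PairSet L V} {gt : L.Term V → L.Term V → Prop}

theorem IsCompatibleReductionOrder.not_gt_succ (hgt : IsCompatibleReductionOrder B gt)
    (f : ℕ → L.Term V) : ¬ ∀ i, gt (f i) (f (i + 1)) := by
  intro h
  obtain ⟨_, ⟨i, rfl⟩, hmin⟩ := hgt.wf.has_min (Set.range f) ⟨_, 0, rfl⟩
  exact hmin _ ⟨i + 1, rfl⟩ (h i)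

/-- Otherwise iterating the context gives an infinite descent `l > c[l] > c[c[l]] > ⋯`. -/
theorem IsCompatibleReductionOrder.not_gt_replaceAt (hgt : IsCompatibleReductionOrder B gt)
    {l c : L.Term V} {p : List ℕ} (hp : IsPos c p) : ¬ gt l (replaceAt c p l) := by
  intro h
  refine hgt.not_gt_succ (fun n => (replaceAt c p)^[n] l) fun n => ?_
  induction n with
  | zero => exact h
  | succ n ih =>
    simp only [Function.iterate_succ_apply'] at ih ⊢
    exact hgt.contextClosed ih hp

/-- Substituting `l` for an extra variable of `r` leaves `l` unchanged and makes it a subterm of the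
smaller side. -/
theorem IsCompatibleReductionOrder.vars_subset (hgt : IsCompatibleReductionOrder B gt)
    {l r : L.Term V} (h : gt l r) : vars r ⊆ vars l := by
  intro x hx
  by_contra hxl
  obtain ⟨p, hp⟩ := exists_subtermAt_of_mem_vars hx
  have h₁ := hgt.substClosed h (single x l)
  have h₂ : subtermAt (r.subst (single x l)) p = some l := by
    simpa [single] using subtermAt_subst hp (single x l)
  rw [subst_single_of_notMem hxl] at h₁
  refine hgt.not_gt_replaceAt (l := l) ⟨_, h₂⟩ ?_
  rwa [replaceAt_self h₂]

theorem IsCompatibleReductionOrder.ne_var (hgt : IsCompatibleReductionOrder B gt)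
    {l r : L.Term V} (h : gt l r) (x : V) : l ≠ .var x := by
  rintro rfl
  by_cases hx : x ∈ vars r
  · obtain ⟨p, hp⟩ := exists_subtermAt_of_mem_vars hx
    refine hgt.not_gt_replaceAt (l := .var x) ⟨_, hp⟩ ?_
    rwa [replaceAt_self hp]
  · have := hgt.substClosed h (single x r)
    rw [subst_single_of_notMem hx] at this
    exact hgt.irrefl r (by simpa [single] using this)

theorem IsCompatibleReductionOrder.gt_of_rewMod (hgt : IsCompatibleReductionOrder B gt)
    {R : PairSet L V} (hR : ∀ a b, Rew R a b → gt a b) {s t : L.Term V} (h : RewMod R B s t) :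
    gt s t := by
  obtain ⟨s', t', hs, h, ht⟩ := h
  exact hgt.compatible _ _ _ _ hs (hR _ _ h) ht

theorem contextClosed_rewMod (R B : PairSet L V) : ContextClosed (RewMod R B) := by
  rintro s t ⟨s', t', hs, h, ht⟩ c p hc
  exact ⟨_, _, contextClosed_conv B hs hc, contextClosed_rew R h hc, contextClosed_conv B ht hc⟩

theorem substClosed_rewMod (R B : PairSet L V) : SubstClosed (RewMod R B) := by
  rintro s t ⟨s', t', hs, h, ht⟩ σ
  exact ⟨_, _, substClosed_conv B hs σ, substClosed_rew R h σ, substClosed_conv B ht σ⟩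

/-! ### Single inference steps -/

variable {E R E' R' T : PairSet L V}

/-- Inference steps only create rules that are contained in the reduction order. -/
theorem Infer.gt_of_mem (hgt : IsCompatibleReductionOrder B gt) (h : Infer B gt E R E' R')
    (hR : ∀ l r, (l, r) ∈ R → gt l r) : ∀ l r, (l, r) ∈ R' → gt l r := by
  cases h with
  | deduce_peak => exact hR
  | deduce_cliff h₁ h₂ =>
    rintro l r (h | h)
    · exact hR l r h
    · obtain ⟨rfl, rfl⟩ := Prod.mk.inj h
      -- The new left-hand side is equivalent to the source of the cliff, which is greater than the
      -- new right-hand side.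
      exact hgt.compatible _ _ _ _ h₂.symm.conv (hgt.gt_of_rew hR _ _ h₁) (Conv.refl _ _)
  | orient _ _ hst =>
    rintro l r (h | h)
    · exact hR l r h
    · obtain ⟨rfl, rfl⟩ := Prod.mk.inj h
      exact hst
  | delete => exact hR
  | simplify => exact hR
  | collapse => exact fun l r h => hR l r (.inl h)
  | @compose _ R s t u _ h₂ =>
    rintro l r (h | h)
    · exact hR l r (.inl h)
    · obtain ⟨rfl, rfl⟩ := Prod.mk.inj h
      exact hgt.trans _ _ _ (hR _ _ (.inr rfl))
        (hgt.gt_of_rewMod (hgt.gt_of_rew fun l r h => hR l r (.inl h)) h₂)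

/-- Inference steps only create equational consequences. -/
theorem Infer.conv_of_mem {F : PairSet L V} (hBF : B ⊆ F) (h : Infer B gt E R E' R')
    (hE : ∀ l r, (l, r) ∈ E ∪ R → Conv F l r) : ∀ l r, (l, r) ∈ E' ∪ R' → Conv F l r := by
  have hrew : ∀ {S : PairSet L V} {a b}, S ⊆ E ∪ R → Rew S a b → Conv F a b := fun hS h =>
    Conv.of_pairs (fun l r h => hE l r (hS h)) h.conv
  have hmod : ∀ {S : PairSet L V} {a b}, S ⊆ E ∪ R → RewMod S B a b → Conv F a b := by
    rintro S a b hS ⟨a', b', ha, h, hb⟩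
    exact (ha.mono hBF).trans ((hrew hS h).trans (hb.mono hBF))
  cases h with
  | deduce_peak h₁ h₂ =>
    rintro l r ((h | h) | h)
    · exact hE l r (.inl h)
    · obtain ⟨rfl, rfl⟩ := Prod.mk.inj h
      exact (hrew Set.subset_union_right h₁).symm.trans (hrew Set.subset_union_right h₂)
    · exact hE l r (.inr h)
  | deduce_cliff h₁ h₂ =>
    rintro l r (h | h | h)
    · exact hE l r (.inl h)
    · exact hE l r (.inr h)
    · obtain ⟨rfl, rfl⟩ := Prod.mk.inj h
      exact (h₂.conv.mono hBF).symm.trans (hrew Set.subset_union_right h₁)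
  | orient _ he _ =>
    rintro l r (h | h | h)
    · exact hE l r (.inl (.inl h))
    · exact hE l r (.inr h)
    · obtain ⟨rfl, rfl⟩ := Prod.mk.inj h
      rcases he with rfl | rfl
      · exact hE _ _ (.inl (.inr rfl))
      · exact (hE _ _ (.inl (.inr rfl))).symm
  | delete =>
    rintro l r (h | h)
    · exact hE l r (.inl (.inl h))
    · exact hE l r (.inr h)
  | simplify _ he hsu =>
    rintro l r ((h | h) | h)
    · exact hE l r (.inl (.inl h))
    · obtain ⟨rfl, rfl⟩ := Prod.mk.inj h
      refine (hmod Set.subset_union_right hsu).symm.trans ?_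
      rcases he with rfl | rfl
      · exact hE _ _ (.inl (.inr rfl))
      · exact (hE _ _ (.inl (.inr rfl))).symm
    · exact hE l r (.inr h)
  | collapse _ hsu =>
    rintro l r ((h | h) | h)
    · exact hE l r (.inl h)
    · obtain ⟨rfl, rfl⟩ := Prod.mk.inj h
      exact (hrew (fun _ h => .inr (.inl h)) hsu).symm.trans (hE _ _ (.inr (.inr rfl)))
    · exact hE l r (.inr (.inl h))
  | compose _ htu =>
    rintro l r (h | h | h)
    · exact hE l r (.inl h)
    · exact hE l r (.inr (.inl h))
    · obtain ⟨rfl, rfl⟩ := Prod.mk.inj h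
      exact (hE _ _ (.inr (.inr rfl))).trans (hmod (fun _ h => .inr (.inl h)) htu)

theorem BoundedConv.of_rewMod {P : L.Term V → Prop} (hP : DownClosed B gt P)
    (hR : ∀ a b, Rew R a b → gt a b)
    (hT : ∀ a b, Rew R a b → P a → P b → BoundedConv T B P a b) {s t : L.Term V}
    (h : RewMod R B s t) (hs : P s) : P t ∧ BoundedConv T B P s t := by
  obtain ⟨s', t', h₁, h₂, h₃⟩ := h
  have hs' := hP.2 _ _ hs h₁
  have ht' := hP.1 _ _ hs' (hR _ _ h₂)
  exact ⟨hP.2 _ _ ht' h₃, (of_conv hP hs h₁).trans ((hT _ _ h₂ hs' ht').trans (of_conv hP ht' h₃))⟩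

/-- Conversions with `T ∪ B` simulate every step with `E`, without leaving any down-closed set of
terms. -/
def Simulates (B : PairSet L V) (gt : L.Term V → L.Term V → Prop) (T E : PairSet L V) : Prop :=
  ∀ P : L.Term V → Prop, DownClosed B gt P →
    ∀ a b, Rew E a b → P a → P b → BoundedConv T B P a b

theorem Infer.simulates (hgt : IsCompatibleReductionOrder B gt) (h : Infer B gt E R E' R')
    (hR : ∀ l r, (l, r) ∈ R → gt l r) (hT : Simulates B gt T (E' ∪ R')) :
    Simulates B gt T (E ∪ R) := by
  intro P hP a b hab ha hb
  obtain ⟨l, r, p, σ, hlr, hs, rfl⟩ := hab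
  have hpos : IsPos a p := ⟨_, hs⟩
  rw [← replaceAt_self hs] at ha ⊢
  rw [replaceAt_replaceAt]
  have hR := hgt.gt_of_rew hR
  have hrew : ∀ {S : PairSet L V} {x y}, Rew S x y →
      Rew S (replaceAt a p (x.subst σ)) (replaceAt a p (y.subst σ)) := fun {S} _ _ h =>
    contextClosed_rew S (substClosed_rew S h σ) hpos
  have hmod : ∀ {S : PairSet L V} {x y}, RewMod S B x y →
      RewMod S B (replaceAt a p (x.subst σ)) (replaceAt a p (y.subst σ)) := fun {S} _ _ h =>
    contextClosed_rewMod S B (substClosed_rewMod S B h σ) hpos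
  have hstep : ∀ {x y}, (x, y) ∈ E' ∪ R' → P (replaceAt a p (x.subst σ)) →
      P (replaceAt a p (y.subst σ)) →
      BoundedConv T B P (replaceAt a p (x.subst σ)) (replaceAt a p (y.subst σ)) :=
    fun h hx hy => hT P hP _ _ (hrew (rew_of_mem h)) hx hy
  cases h with
  | deduce_peak => exact hstep (hlr.imp .inl id) ha hb
  | deduce_cliff => exact hstep (hlr.imp id .inl) ha hb
  | orient _ he _ =>
    rcases hlr with (h | h) | h
    · exact hstep (.inl h) ha hb
    · obtain rfl := Set.mem_singleton_iff.1 h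
      rcases he with he | he
      · obtain ⟨rfl, rfl⟩ := Prod.mk.inj he
        exact hstep (.inr (.inr rfl)) ha hb
      · obtain ⟨rfl, rfl⟩ := Prod.mk.inj he
        exact (hstep (.inr (.inr rfl)) hb ha).symm
    · exact hstep (.inr (.inl h)) ha hb
  | delete _ hst =>
    rcases hlr with (h | h) | h
    · exact hstep (.inl h) ha hb
    · obtain ⟨rfl, rfl⟩ := Prod.mk.inj h
      exact .of_conv hP ha (contextClosed_conv B (substClosed_conv B hst σ) hpos)
    · exact hstep (.inr h) ha hb
  | simplify _ he hsu =>
    rcases hlr with (h | h) | h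
    · exact hstep (.inl (.inl h)) ha hb
    · obtain rfl := Set.mem_singleton_iff.1 h
      have hT' := fun a b (h : Rew R a b) => hT P hP a b (h.mono Set.subset_union_right)
      rcases he with he | he
      · obtain ⟨rfl, rfl⟩ := Prod.mk.inj he
        obtain ⟨hu, h⟩ := BoundedConv.of_rewMod hP hR hT' (hmod hsu) ha
        exact h.trans (hstep (.inl (.inr rfl)) hu hb)
      · obtain ⟨rfl, rfl⟩ := Prod.mk.inj he
        -- The simplified side is the right one here, so the conversion is built from the target and
        -- then reversed.
        obtain ⟨hu, h⟩ := BoundedConv.of_rewMod hP hR hT' (hmod hsu) hb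
        exact (h.trans (hstep (.inl (.inr rfl)) hu ha)).symm
    · exact hstep (.inr h) ha hb
  | collapse _ hsu =>
    rcases hlr with h | h | h
    · exact hstep (.inl (.inl h)) ha hb
    · exact hstep (.inr h) ha hb
    · obtain ⟨rfl, rfl⟩ := Prod.mk.inj h
      -- The detour through `u` stays in `P` because `u` is below the old left-hand side.
      have hu := hP.1 _ _ ha (hR _ _ ((hrew hsu).mono Set.subset_union_left))
      exact (hT P hP _ _ ((hrew hsu).mono Set.subset_union_right) ha hu).trans
        (hstep (.inl (.inr rfl)) hu hb)
  | compose _ htu =>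
    rcases hlr with h | h | h
    · exact hstep (.inl h) ha hb
    · exact hstep (.inr (.inl h)) ha hb
    · obtain ⟨rfl, rfl⟩ := Prod.mk.inj h
      obtain ⟨hu, h⟩ := BoundedConv.of_rewMod hP (fun a b h => hR a b (h.mono
        Set.subset_union_left)) (fun a b h => hT P hP a b (h.mono fun _ h => .inr (.inl h)))
        (hmod htu) hb
      exact (hstep (.inr (.inr rfl)) ha hu).trans h.symm

/-- Every step with `R` can be replaced by a step with `T` followed by a conversion through smaller
terms. -/
def SimulatesRules (B : PairSet L V) (gt : L.Term V → L.Term V → Prop) (T R : PairSet L V) :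
    Prop :=
  ∀ a b, Rew R a b → ∃ v, Rew T a v ∧ BoundedConv T B (gt a) v b

theorem Infer.simulatesRules (hgt : IsCompatibleReductionOrder B gt)
    (h : Infer B gt E R E' R') (hR : ∀ l r, (l, r) ∈ R → gt l r)
    (hT : Simulates B gt T (E' ∪ R')) (hT' : SimulatesRules B gt T R') :
    SimulatesRules B gt T R := by
  have hsub : R ⊆ R' → SimulatesRules B gt T R := fun hRR a b h => hT' a b (h.mono hRR)
  have hgtR := hgt.gt_of_rew hR
  intro a b hab
  have hgtab := hgtR a b hab
  obtain ⟨l, r, p, σ, hlr, hs, rfl⟩ := id hab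
  have hpos : IsPos a p := ⟨_, hs⟩
  have ha : replaceAt a p (l.subst σ) = a := replaceAt_self hs
  have hmem : ∀ {S : PairSet L V} {x y}, Rew S x y →
      Rew S (replaceAt a p (x.subst σ)) (replaceAt a p (y.subst σ)) := fun {S} _ _ h =>
    contextClosed_rew S (substClosed_rew S h σ) hpos
  have hP := hgt.downClosed a
  cases h with
  | deduce_peak => exact hsub subset_rfl a _ hab
  | deduce_cliff => exact hsub Set.subset_union_left a _ hab
  | orient => exact hsub Set.subset_union_left a _ hab
  | delete => exact hsub subset_rfl a _ hab
  | simplify => exact hsub subset_rfl a _ hab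
  | collapse _ hsu =>
    rcases hlr with h | h
    · exact hT' _ _ ⟨l, r, p, σ, h, hs, rfl⟩
    · obtain ⟨rfl, rfl⟩ := Prod.mk.inj h
      have hau := hmem hsu
      rw [ha] at hau
      -- Collapse uses a plain `R`-step, so the first step really starts at `a`; a step modulo `B`
      -- would only start at some term equivalent to `a`.
      obtain ⟨v, hv, hvu⟩ := hT' _ _ hau
      have hu := hgtR _ _ (hau.mono Set.subset_union_left)
      exact ⟨v, hv, hvu.trans
        (hT _ hP _ _ (hmem (rew_of_mem (.inl (.inr rfl)))) hu hgtab)⟩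
  | compose _ htu =>
    rcases hlr with h | h
    · exact hT' _ _ ⟨l, r, p, σ, .inl h, hs, rfl⟩
    · obtain ⟨rfl, rfl⟩ := Prod.mk.inj h
      obtain ⟨-, h⟩ := BoundedConv.of_rewMod hP (fun a b h => hgtR a b (h.mono
        Set.subset_union_left)) (fun a b h => hT _ hP a b (h.mono fun _ h => .inr (.inl h)))
        (contextClosed_rewMod _ B (substClosed_rewMod _ B htu σ) hpos) hgtab
      -- The composed rule keeps its left-hand side and supplies the first step; the conversion back
      -- from `u` to `t` lies below `a`.
      obtain ⟨v, hv, hvu⟩ := hT' _ _ ⟨_, _, p, σ, .inr rfl, hs, rfl⟩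
      exact ⟨v, hv, hvu.trans h.symm⟩

theorem simulates_of_empty_union : Simulates B gt T (∅ ∪ T) := by
  intro P _ a b h ha hb
  rw [Set.empty_union] at h
  exact .of_rew ha hb h

/-! ### Complete runs and fairness -/

variable {Es Rs : ℕ → PairSet L V} {n : ℕ}

theorem IsRun.gt_of_mem (hgt : IsCompatibleReductionOrder B gt) (h : IsRun B gt E Es Rs n)
    {i : ℕ} (hi : i ≤ n) : ∀ l r, (l, r) ∈ Rs i → gt l r := by
  induction i with
  | zero => simp [h.2.1]
  | succ i ih => exact (h.2.2 i hi).gt_of_mem hgt (ih (Nat.le_of_succ_le hi))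

theorem IsRun.conv_of_mem (h : IsRun B gt E Es Rs n) {i : ℕ} (hi : i ≤ n) :
    ∀ l r, (l, r) ∈ Es i ∪ Rs i → Conv (E ∪ B) l r := by
  induction i with
  | zero =>
    rw [h.1, h.2.1, Set.union_empty]
    exact fun l r h => (rew_of_mem (.inl h)).conv
  | succ i ih =>
    exact (h.2.2 i hi).conv_of_mem Set.subset_union_right (ih (Nat.le_of_succ_le hi))

theorem IsRun.simulates (hgt : IsCompatibleReductionOrder B gt) (h : IsRun B gt E Es Rs n)
    (hn : Es n = ∅) {i : ℕ} (hi : i ≤ n) :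
    Simulates B gt (Rs n) (Es i ∪ Rs i) ∧ SimulatesRules B gt (Rs n) (Rs i) := by
  induction hi using Nat.decreasingInduction with
  | self => exact ⟨hn ▸ simulates_of_empty_union, fun a b h => ⟨b, h, .refl⟩⟩
  | of_succ i hi ih =>
    have hR := h.gt_of_mem hgt hi.le
    exact ⟨(h.2.2 i hi).simulates hgt hR ih.1, (h.2.2 i hi).simulatesRules hgt hR ih.1 ih.2⟩

/-- Fairness yields source-decreasing local peaks and cliffs. -/
theorem IsRun.churchRosserMod [Infinite V] (hB : ∀ l r, (l, r) ∈ B → vars l = vars r)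
    (hgt : IsCompatibleReductionOrder B gt) (h : IsRun B gt E Es Rs n)
    (hfair : IsFair B Es Rs n) (hn : Es n = ∅) : ChurchRosserMod (Rs n) B := by
  obtain ⟨hlin, hPCP, hPCP'⟩ := hfair
  have hgtn := hgt.gt_of_rew (h.gt_of_mem hgt le_rfl)
  have hvars : ∀ l r, (l, r) ∈ Rs n → vars r ⊆ vars l := fun l r hlr =>
    hgt.vars_subset (h.gt_of_mem hgt le_rfl l r hlr)
  have hclosed : ∀ F : ℕ → PairSet L V,
      ContextClosed (fun t u => Valley (Rs n) B t u ∨ ∃ i ≤ n, SymRew (F i) t u) ∧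
      SubstClosed (fun t u => Valley (Rs n) B t u ∨ ∃ i ≤ n, SymRew (F i) t u) := by
    intro F
    constructor
    · rintro t u (h | ⟨i, hi, h⟩) c p hc
      · exact .inl (contextClosed_valley _ _ h hc)
      · exact .inr ⟨i, hi, contextClosed_symRew _ h hc⟩
    · rintro t u (h | ⟨i, hi, h⟩) σ
      · exact .inl (substClosed_valley _ _ h σ)
      · exact .inr ⟨i, hi, substClosed_symRew _ h σ⟩
  have hsymm : ∀ (F : ℕ → PairSet L V) (t u : L.Term V),
      (Valley (Rs n) B t u ∨ ∃ i ≤ n, SymRew (F i) t u) →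
      Valley (Rs n) B u t ∨ ∃ i ≤ n, SymRew (F i) u t := by
    rintro F t u (h | ⟨i, hi, h⟩)
    · exact .inl h.symm
    · exact .inr ⟨i, hi, h.symm⟩
  have hpeak : ∀ {s t u}, Rew (Rs n) s t → Rew (Rs n) s u →
      (Valley (Rs n) B t u ∨ ∃ i ≤ n, SymRew (Es i ∪ Rs i) t u) →
      BoundedConv (Rs n) B (gt s) t u := by
    intro s t u ht hu htu
    have hP := hgt.downClosed s
    rcases htu with htu | ⟨i, hi, htu | htu⟩
    · exact .of_valley hP hgtn (hgtn _ _ ht) (hgtn _ _ hu) htu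
    · exact (h.simulates hgt hn hi).1 _ hP _ _ htu (hgtn _ _ ht) (hgtn _ _ hu)
    · exact ((h.simulates hgt hn hi).1 _ hP _ _ htu (hgtn _ _ hu) (hgtn _ _ ht)).symm
  have hcliff : ∀ {s t u}, Rew (Rs n) s t → SymRew B s u →
      (Valley (Rs n) B t u ∨ ∃ i ≤ n, SymRew (Rs i) t u) →
      ∃ v, Rew (Rs n) u v ∧ BoundedConv (Rs n) B (gt s) v t := by
    intro s t u ht hu htu
    have hP := hgt.downClosed s
    have hgtut : gt u t := hgt.compatible _ _ _ _ hu.symm.conv (hgtn _ _ ht) (Conv.refl _ _)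
    have hgtu : ∀ x, gt u x → gt s x := fun x hx =>
      hgt.compatible _ _ _ _ hu.conv hx (Conv.refl _ _)
    rcases htu with ⟨t', u', ht', htu, hu'⟩ | ⟨i, hi, htu | htu⟩
    · obtain ⟨hst', htt'⟩ := BoundedConv.of_reflTransGen (R := Rs n) hP hgtn (hgtn _ _ ht) ht'
      rcases hu'.cases_head with rfl | ⟨v, hv, hvu⟩
      -- The valley must contain a step from `u`: otherwise `s > t' ∼ u ∼ s`.
      · exact absurd (hP.2 _ _ (hP.2 _ _ hst' htu) hu.symm.conv) (hgt.irrefl s)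
      · have hsv := hgtu _ (hgtn _ _ hv)
        exact ⟨v, hv, .of_valley hP hgtn hsv (hgtn _ _ ht) ⟨u', t', hvu, htu.symm, ht'⟩⟩
    -- A rule cannot lead from `t` to `u`, because `u ∼ s > t`.
    · exact absurd (hgt.trans _ _ _ hgtut (hgt.gt_of_rew (h.gt_of_mem hgt hi) _ _ htu))
        (hgt.irrefl u)
    -- This is why cliffs may be covered by rules only: the simulation of an equation between `u`
    -- and `t` need not begin with a rewrite step from `u`.
    · obtain ⟨v, hv, hvt⟩ := (h.simulates hgt hn hi).2 _ _ htu
      exact ⟨v, hv, Relation.ReflTransGen.mono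
        (fun x y ⟨hx, hy, h⟩ => ⟨hgtu x hx, hgtu y hy, h⟩) _ _ hvt⟩
  have hK := hclosed fun i => Es i ∪ Rs i
  have hK' := hclosed Rs
  refine churchRosserMod_of_local hgt hgtn ?_ ?_
  · intro s t u ht hu
    rcases peak_cases hvars hK.1 hK.2 (hsymm _) (fun _ _ => .inl) hPCP ht hu with
      htu | ⟨v, hv, htv, hvu⟩
    · exact hpeak ht hu htu
    · exact (hpeak ht hv htv).trans (hpeak hv hu hvu)
  · intro s t u ht hu
    rcases cliff_cases hvars hlin hB hK.1 hK.2 (fun _ _ => .inl) hPCP hK'.1 hK'.2 (hsymm _)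
      (fun _ _ => .inl) hPCP' ht hu with htu | ⟨v, hv, hvt, hvu⟩
    · exact hcliff ht hu htu
    · obtain ⟨w, hw, hwv⟩ := hcliff hv hu hvu
      exact ⟨w, hw, hwv.trans (hpeak hv ht hvt)⟩

end Runs

end TRS

theorem mainTheorem2 {L : FirstOrder.Language.{u, v}} {V : Type w} [Infinite V]
    (B : TRS.PairSet L V) (hB : ∀ l r, (l, r) ∈ B → TRS.vars l = TRS.vars r)
    (gt : L.Term V → L.Term V → Prop) (hgt : TRS.IsCompatibleReductionOrder B gt)
    (E : TRS.PairSet L V) (n : ℕ) (Es Rs : ℕ → TRS.PairSet L V)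
    (hrun : TRS.IsRun B gt E Es Rs n) (hfair : TRS.IsFair B Es Rs n)
    (hnonfailing : ¬ TRS.Fails Es n) :
    TRS.IsCompleteRepresentation B (Rs n) E := by
  have hn : Es n = ∅ := not_not.1 hnonfailing
  have hR := hrun.gt_of_mem hgt le_rfl
  refine ⟨fun l r h => ⟨hgt.ne_var (hR l r h), hgt.vars_subset (hR l r h)⟩, ?_, ?_,
    hrun.churchRosserMod hB hgt hfair hn⟩
  · refine fun s t => ⟨TRS.Conv.of_pairs ?_, TRS.Conv.of_pairs ?_⟩
    · rintro l r (h | h)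
      · have hsim := (hrun.simulates hgt hn (Nat.zero_le n)).1
        -- For the equational theory alone no bound on the terms is needed.
        refine (hsim (fun _ => True) ⟨fun _ _ _ _ => trivial, fun _ _ _ _ => trivial⟩ l r
          (TRS.rew_of_mem (.inl ?_)) trivial trivial).conv
        rwa [hrun.1]
      · exact (TRS.rew_of_mem (.inr h)).conv
    · rintro l r (h | h)
      · exact hrun.conv_of_mem le_rfl l r (.inr h)
      · exact (TRS.rew_of_mem (.inr h)).conv
  · rintro ⟨f, hf⟩
    exact hgt.not_gt_succ f fun i => hgt.gt_of_rewMod (hgt.gt_of_rew hR) (hf i)
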